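/- Let $n\ge 1$, let $\mathcal C$ be an additive category, $\mathbb E\colon\mathcal C^{\rm op}\times\mathcal C\to \mathrm{Ab}$ an additive bifunctor, and let $(\mathcal C,\mathbb E,\mathfrak s)$ be an $n$-exangulated category in the sense of Herschend–Liu–Nakaoka. A pair $\langle X^\bullet,\delta\rangle$ with $X^\bullet\colon X^0\to X^1\to\cdots\to X^{n+1}$ and $\delta\in\mathbb E(X^{n+1},X^0)$ is a distinguished $n$-exangle if $\mathfrak s(\delta)=[X^\bullet]$. Then $d_X^0$ is called an inflation and $d_X^n$ a deflation; the inflations (deflations) that arise from a member of a class $\xi$ of distinguished $n$-exangles are called $\xi$-inflations ($\xi$-deflations). A morphism $f^\bullet\colon\langle X^\bullet,\delta\rangle\to\langle Y^\bullet,\rho\rangle$ of distinguished $n$-exangles (a morphism of complexes with $(f^0)_*\delta=(f^{n+1})^*\rho$) is a weak isomorphism if $f^0$ and $f^{n+1}$ are isomorphisms. A class $\xi$ of distinguished $n$-exangles is $n$-proper if (i) it contains every distinguished $n$-exangle $\langle X^\bullet,0\rangle$, and is closed under weak isomorphisms and finite coproducts; (ii) it is closed under base change and cobase change: if $\langle X^\bullet,\delta\rangle\in\xi$,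 with $\delta\in\mathbb E(C,A)$, then for all $c\colon C'\to C$ and $a\colon A\to A'$ every distinguished $n$-exangle $\langle Y^\bullet,c^*\delta\rangle$ and every distinguished $n$-exangle $\langle Y^\bullet,a_*\delta\rangle$ belongs to $\xi$; (iii) it is saturated: whenever $ba=dc$ with $a\colon A\to B$, $b\colon B\to D$, $c\colon A\to C$, $d\colon C\to D$, where $a,b,d$ are deflations and $a,b$ are $\xi$-deflations, then $d$ is a $\xi$-deflation. Put $\mathbb E_\xi(C,A)=\{\delta\in\mathbb E(C,A)\mid \langle X^\bullet,\delta\rangle\in\xi\text{ for some }X^\bullet\}$ and $\mathfrak s_\xi=\mathfrak s|_{\mathbb E_\xi}$. Saying that $(\mathcal C,\mathbb E_\xi,\mathfrak s_\xi)$ is $n$-exangulated or $n$-exact includes that $\mathbb E_\xi$ is an additive sub-bifunctor of $\mathbb E$. An $n$-exangulated category is said to be $n$-exact if it is the one induced by an $n$-exact structure in the sense of Jasso: its conflations are the admissible $n$-exact sequences of such a structure, and $\delta\mapsto\mathfrak s(\delta)$ identifies $\mathbb E(C,A)$ with the homotopy classes of admissible $n$-exact sequences from $A$ to $C$. It is said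 to be $(n+2)$-angulated if it is the one induced by an $(n+2)$-angulated category $(\mathcal C,\Sigma,\Theta)$ in the sense of Geiss–Keller–Oppermann: $\mathbb E(C,A)\cong\mathcal C(C,\Sigma A)$ naturally, and under this isomorphism the distinguished $n$-exangles are the $(n+2)$-angles. A class of admissible $n$-exact sequences, respectively of $(n+2)$-angles, is called closed under weak isomorphisms, or $n$-proper, if the class of distinguished $n$-exangles it induces is so; $\mathbb E_\xi$ and $\mathfrak s_\xi$ are formed with this induced class. (1) If $(\mathcal C,\mathbb E,\mathfrak s)$ is an $n$-exact category and $\xi$ is a class of (admissible) $n$-exact sequences which is closed under weak isomorphisms, then $\xi$ is $n$-proper if and only if $(\mathcal C,\mathbb E_\xi,\mathfrak s_\xi)$ is an $n$-exact category. (2) If $(\mathcal C,\mathbb E,\mathfrak s)$ is an $(n+2)$-angulated category and $\xi$ is a class of $(n+2)$-angles which is closed under weak isomorphisms, then $\xi$ is $n$-proper if and only if $(\mathcal C,\mathbb E_\xi,\mathfrak s_\xi)$ is an $n$-exangulated category. -/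

import Mathlib

open CategoryTheory CategoryTheory.Limits Opposite

universe w v u

namespace NExang

variable {𝓒 : Type u} [Category.{v} 𝓒] [Preadditive 𝓒]

/-! ## Sequences `X⁰ ⟶ X¹ ⟶ ⋯ ⟶ Xⁿ⁺¹` with given ends -/

/-- A complex `X⁰ ⟶ X¹ ⟶ ⋯ ⟶ Xⁿ⁺¹` in `𝓒` (a cochain complex which vanishes outside of the degrees
`0, …, n + 1`) whose end terms are identified with `A` and `C`. Identifying the ends through the
isomorphisms `α`, `γ`, in place of an equality of objects, gives a category equivalent to the
category of complexes with `X⁰ = A` and `Xⁿ⁺¹ = C` and morphisms that are the identity in the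
degrees `0` and `n + 1`; the two have the same homotopy classes. -/
structure NSeq (n : ℕ) (A C : 𝓒) where
  /-- the underlying complex -/
  K : CochainComplex 𝓒 ℕ
  isZero : ∀ i, n + 1 < i → IsZero (K.X i)
  /-- the identification of the first term -/
  α : K.X 0 ≅ A
  /-- the identification of the last term -/
  γ : K.X (n + 1) ≅ C

namespace NSeq

variable {n : ℕ}

/-- The first differential `d⁰ : A ⟶ X¹`. -/
def inf {A C : 𝓒} (X : NSeq n A C) : A ⟶ X.K.X 1 := X.α.inv ≫ X.K.d 0 1

/-- The last differential `dⁿ : Xⁿ ⟶ C`. -/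
def defl {A C : 𝓒} (X : NSeq n A C) : X.K.X n ⟶ C := X.K.d n (n + 1) ≫ X.γ.hom

/-- The morphism of complexes `f` is of the form `(a, f¹, …, fⁿ, c)`. -/
structure Lifts {A C A' C' : 𝓒} {X : NSeq n A C} {Y : NSeq n A' C'} (f : X.K ⟶ Y.K)
    (a : A ⟶ A') (c : C ⟶ C') : Prop where
  left : f.f 0 ≫ Y.α.hom = X.α.hom ≫ a
  right : f.f (n + 1) ≫ Y.γ.hom = X.γ.hom ≫ c

/-- Homotopy equivalence of complexes with the same ends, through morphisms that are the identity
at both ends; the homotopies are the usual homotopies of complexes. -/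
def HtpyEquiv {A C : 𝓒} (X Y : NSeq n A C) : Prop :=
  ∃ e : HomotopyEquiv X.K Y.K,
    Lifts (X := X) (Y := Y) e.hom (𝟙 A) (𝟙 C) ∧ Lifts (X := Y) (Y := X) e.inv (𝟙 A) (𝟙 C)

theorem Lifts.comp {A C : 𝓒} {X Y Z : NSeq n A C} {f : X.K ⟶ Y.K} {g : Y.K ⟶ Z.K}
    (hf : Lifts (X := X) (Y := Y) f (𝟙 A) (𝟙 C)) (hg : Lifts (X := Y) (Y := Z) g (𝟙 A) (𝟙 C)) :
    Lifts (X := X) (Y := Z) (f ≫ g) (𝟙 A) (𝟙 C) := by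
  constructor
  · have h1 := hf.left
    have h2 := hg.left
    simp only [Category.comp_id] at h1 h2 ⊢
    simp [h1, h2]
  · have h1 := hf.right
    have h2 := hg.right
    simp only [Category.comp_id] at h1 h2 ⊢
    simp [h1, h2]

/-- Homotopy equivalence as a setoid. -/
instance htpySetoid (n : ℕ) (A C : 𝓒) : Setoid (NSeq n A C) where
  r := HtpyEquiv
  iseqv :=
    { refl := fun X => ⟨HomotopyEquiv.refl X.K, ⟨by simp [HomotopyEquiv.refl],
        by simp [HomotopyEquiv.refl]⟩, ⟨by simp [HomotopyEquiv.refl], by simp [HomotopyEquiv.refl]⟩⟩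
      symm := fun ⟨e, h1, h2⟩ => ⟨e.symm, h2, h1⟩
      trans := fun ⟨e, h1, h2⟩ ⟨e', h1', h2'⟩ => ⟨e.trans e', h1.comp h1', h2'.comp h2⟩ }

/-- The direct sum of two sequences. -/
noncomputable def sum [HasBinaryBiproducts 𝓒] {A C A' C' : 𝓒}
    (X : NSeq n A C) (Y : NSeq n A' C') : NSeq n (A ⊞ A') (C ⊞ C') where
  K := X.K ⊞ Y.K
  isZero := fun i hi => by
    refine IsZero.of_iso ?_ (HomologicalComplex.biprodXIso X.K Y.K i)
    rw [IsZero.iff_id_eq_zero]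
    apply biprod.hom_ext'
    · exact (X.isZero i hi).eq_of_src _ _
    · exact (Y.isZero i hi).eq_of_src _ _
  α := HomologicalComplex.biprodXIso X.K Y.K 0 ≪≫ biprod.mapIso X.α Y.α
  γ := HomologicalComplex.biprodXIso X.K Y.K (n + 1) ≪≫ biprod.mapIso X.γ Y.γ

end NSeq

/-- The set of homotopy classes of sequences from `A` to `C`. -/
abbrev HoClass (n : ℕ) (A C : 𝓒) := Quotient (NSeq.htpySetoid n A C)

/-- A class of sequences. -/
abbrev SeqClass (𝓒 : Type u) [Category.{v} 𝓒] [Preadditive 𝓒] (n : ℕ) :=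
  ∀ ⦃A C : 𝓒⦄, NSeq n A C → Prop

/-- `f = d⁰` for some sequence of the class `𝒳`. -/
def IsInflation {n : ℕ} (𝒳 : SeqClass 𝓒 n) {A B : 𝓒} (f : A ⟶ B) : Prop :=
  ∃ (C : 𝓒) (X : NSeq n A C) (e : X.K.X 1 ≅ B), 𝒳 X ∧ X.inf ≫ e.hom = f

/-- `g = dⁿ` for some sequence of the class `𝒳`. -/
def IsDeflation {n : ℕ} (𝒳 : SeqClass 𝓒 n) {B C : 𝓒} (g : B ⟶ C) : Prop :=
  ∃ (A : 𝓒) (X : NSeq n A C) (e : X.K.X n ≅ B), 𝒳 X ∧ e.inv ≫ X.defl = g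

/-- `𝓒(W, K⁰) ⟶ ⋯ ⟶ 𝓒(W, Kⁿ⁺¹)` is exact at the places `1, …, n`, for every `W`. -/
def CovExact (n : ℕ) (K : CochainComplex 𝓒 ℕ) : Prop :=
  ∀ (W : 𝓒) (i : ℕ), i < n → ∀ g : W ⟶ K.X (i + 1), g ≫ K.d (i + 1) (i + 2) = 0 →
    ∃ k : W ⟶ K.X i, k ≫ K.d i (i + 1) = g

/-- `𝓒(Kⁿ⁺¹, W) ⟶ ⋯ ⟶ 𝓒(K⁰, W)` is exact at the places `n, …, 1`, for every `W`. -/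
def ContraExact (n : ℕ) (K : CochainComplex 𝓒 ℕ) : Prop :=
  ∀ (W : 𝓒) (i : ℕ), i < n → ∀ g : K.X (i + 1) ⟶ W, K.d i (i + 1) ≫ g = 0 →
    ∃ k : K.X (i + 2) ⟶ W, K.d (i + 1) (i + 2) ≫ k = g

/-! ## Mapping cones and cocones -/

/-- The mapping cone
`K¹ ⟶ K² ⊕ L¹ ⟶ K³ ⊕ L² ⟶ ⋯ ⟶ Kⁿ⁺¹ ⊕ Lⁿ ⟶ Lⁿ⁺¹`
of `f : K ⟶ L`, given up to isomorphism by the decomposition of its terms. The differentials are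
`(-d ; f)`, then `(-d 0 ; f d)`, and at last `(f d)`. -/
structure MappingCone [HasBinaryBiproducts 𝓒] (n : ℕ) {K L : CochainComplex 𝓒 ℕ} (f : K ⟶ L) where
  /-- the underlying sequence -/
  seq : NSeq n (K.X 1) (L.X (n + 1))
  /-- the decomposition of the terms in the degrees `1, …, n` -/
  e : ∀ i : ℕ, 1 ≤ i → i ≤ n → (seq.K.X i ≅ K.X (i + 1) ⊞ L.X i)
  inf_comm : ∀ h : 1 ≤ n,
    seq.inf ≫ (e 1 le_rfl h).hom = biprod.lift (-K.d 1 2) (f.f 1)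
  d_comm : ∀ (i : ℕ) (h₁ : 1 ≤ i) (h₂ : i + 1 ≤ n),
    seq.K.d i (i + 1) ≫ (e (i + 1) (Nat.le_add_left 1 i) h₂).hom =
      (e i h₁ (Nat.le_of_succ_le h₂)).hom ≫
        biprod.desc (biprod.lift (-K.d (i + 1) (i + 2)) (f.f (i + 1)))
          (biprod.lift 0 (L.d i (i + 1)))
  defl_comm : ∀ h : 1 ≤ n,
    seq.defl = (e n h le_rfl).hom ≫ biprod.desc (f.f (n + 1)) (L.d n (n + 1))

/-- The mapping cocone
`K⁰ ⟶ K¹ ⊕ L⁰ ⟶ K² ⊕ L¹ ⟶ ⋯ ⟶ Kⁿ ⊕ Lⁿ⁻¹ ⟶ Lⁿ`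
of `h : K ⟶ L`, given up to isomorphism by the decomposition of its terms. The differentials are
`(d ; h)`, then `(d 0 ; h -d)`, and at last `(h -d)`; this is the mapping cone formed in the
opposite category. Only the degrees `0, …, n` of `h` enter. -/
structure MappingCocone [HasBinaryBiproducts 𝓒] (n : ℕ) {K L : CochainComplex 𝓒 ℕ}
    (h : K ⟶ L) where
  /-- the underlying sequence -/
  seq : NSeq n (K.X 0) (L.X n)
  /-- the decomposition of the terms in the degrees `1, …, n` -/
  e : ∀ i j : ℕ, i + 1 = j → j ≤ n → (seq.K.X j ≅ K.X j ⊞ L.X i)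
  inf_comm : ∀ h₁ : 1 ≤ n,
    seq.inf ≫ (e 0 1 rfl h₁).hom = biprod.lift (K.d 0 1) (h.f 0)
  d_comm : ∀ (i : ℕ) (h₂ : i + 2 ≤ n),
    seq.K.d (i + 1) (i + 2) ≫ (e (i + 1) (i + 2) rfl h₂).hom =
      (e i (i + 1) rfl (Nat.le_of_succ_le h₂)).hom ≫
        biprod.desc (biprod.lift (K.d (i + 1) (i + 2)) (h.f (i + 1)))
          (biprod.lift 0 (-L.d i (i + 1)))
  defl_comm : ∀ (i : ℕ) (hi : i + 1 = n),
    seq.defl = (e i n hi le_rfl).hom ≫ biprod.desc (h.f n) (-L.d i n)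

/-! ## Extensions and realizations -/

/-- The group `𝔼(C, A)` of extensions. -/
abbrev Ext (E : 𝓒ᵒᵖ ⥤ 𝓒 ⥤ AddCommGrpCat.{w}) (C A : 𝓒) : Type w := (E.obj (op C)).obj A

/-- `a_* δ`. -/
def push (E : 𝓒ᵒᵖ ⥤ 𝓒 ⥤ AddCommGrpCat.{w}) {C A A' : 𝓒} (a : A ⟶ A') (δ : Ext E C A) :
    Ext E C A' :=
  (E.obj (op C)).map a δ

/-- `c^* δ`. -/
def pull (E : 𝓒ᵒᵖ ⥤ 𝓒 ⥤ AddCommGrpCat.{w}) {C C' A : 𝓒} (c : C' ⟶ C) (δ : Ext E C A) :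
    Ext E C' A :=
  (E.map c.op).app A δ

/-- `δ ⊕ δ'`. -/
noncomputable def extSum [HasBinaryBiproducts 𝓒] (E : 𝓒ᵒᵖ ⥤ 𝓒 ⥤ AddCommGrpCat.{w})
    {A C A' C' : 𝓒} (δ : Ext E C A) (δ' : Ext E C' A') : Ext E (C ⊞ C') (A ⊞ A') :=
  pull E biprod.fst (push E biprod.inl δ) + pull E biprod.snd (push E biprod.inr δ')

/-- A correspondence that associates a homotopy class of sequences from `A` to `C` to each
extension `δ ∈ 𝔼(C, A)`. -/
abbrev Corr (n : ℕ) (E : 𝓒ᵒᵖ ⥤ 𝓒 ⥤ AddCommGrpCat.{w}) :=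
  ∀ ⦃A C : 𝓒⦄, Ext E C A → HoClass n A C

/-- The pair `⟨X, δ⟩` is an `n`-exangle. -/
structure IsExangle (E : 𝓒ᵒᵖ ⥤ 𝓒 ⥤ AddCommGrpCat.{w}) {n : ℕ} {A C : 𝓒}
    (X : NSeq n A C) (δ : Ext E C A) : Prop where
  cov : CovExact n X.K
  cov_last : ∀ (W : 𝓒) (g : W ⟶ C), pull E g δ = 0 ↔ ∃ k : W ⟶ X.K.X n, k ≫ X.defl = g
  contra : ContraExact n X.K
  contra_last : ∀ (W : 𝓒) (g : A ⟶ W), push E g δ = 0 ↔ ∃ k : X.K.X 1 ⟶ W, X.inf ≫ k = g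

/-- The class of conflations: the sequences that realize some extension. -/
def Conf {n : ℕ} {E : 𝓒ᵒᵖ ⥤ 𝓒 ⥤ AddCommGrpCat.{w}} (s : Corr n E) : SeqClass 𝓒 n :=
  fun _ _ X => ∃ δ, s δ = ⟦X⟧

/-- `(𝓒, E, s)` is an `n`-exangulated category. -/
structure IsNExangulated [HasBinaryBiproducts 𝓒] (n : ℕ) (E : 𝓒ᵒᵖ ⥤ 𝓒 ⥤ AddCommGrpCat.{w})
    (s : Corr n E) : Prop where
  /-- `E` is an additive bifunctor -/
  additive_left : E.Additive
  additive_right : ∀ C : 𝓒, (E.obj (op C)).Additive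
  /-- (R0) every morphism of extensions has a lift -/
  exists_lift : ∀ {A C A' C' : 𝓒} (δ : Ext E C A) (ρ : Ext E C' A') (X : NSeq n A C)
    (Y : NSeq n A' C'), s δ = ⟦X⟧ → s ρ = ⟦Y⟧ → ∀ (a : A ⟶ A') (c : C ⟶ C'),
    push E a δ = pull E c ρ → ∃ f : X.K ⟶ Y.K, NSeq.Lifts (X := X) (Y := Y) f a c
  /-- (R1) -/
  exangle : ∀ {A C : 𝓒} (δ : Ext E C A) (X : NSeq n A C), s δ = ⟦X⟧ → IsExangle E X δ
  /-- (R2) `s(0) = [A = A ⟶ 0 ⟶ ⋯ ⟶ 0]` for `0 ∈ 𝔼(0, A)` -/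
  split_left : ∀ {A Z : 𝓒} (_ : IsZero Z) (X : NSeq n A Z), IsIso X.inf →
    (∀ i, 2 ≤ i → IsZero (X.K.X i)) → s (0 : Ext E Z A) = ⟦X⟧
  /-- (R2), dual: `s(0) = [0 ⟶ ⋯ ⟶ 0 ⟶ A = A]` for `0 ∈ 𝔼(A, 0)` -/
  split_right : ∀ {A Z : 𝓒} (_ : IsZero Z) (X : NSeq n Z A), IsIso X.defl →
    (∀ i, i < n → IsZero (X.K.X i)) → s (0 : Ext E A Z) = ⟦X⟧
  /-- (EA1) -/
  inflation_comp : ∀ {A B C : 𝓒} (f : A ⟶ B) (g : B ⟶ C),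
    IsInflation (Conf s) f → IsInflation (Conf s) g → IsInflation (Conf s) (f ≫ g)
  deflation_comp : ∀ {A B C : 𝓒} (f : A ⟶ B) (g : B ⟶ C),
    IsDeflation (Conf s) f → IsDeflation (Conf s) g → IsDeflation (Conf s) (f ≫ g)
  /-- (EA2) `(1, c)` has a lift whose mapping cone realizes `(d⁰_X)_* ρ` -/
  good_lift : ∀ {A C D : 𝓒} (ρ : Ext E D A) (c : C ⟶ D) (X : NSeq n A C) (Y : NSeq n A D),
    s (pull E c ρ) = ⟦X⟧ → s ρ = ⟦Y⟧ →
    ∃ f : X.K ⟶ Y.K, NSeq.Lifts (X := X) (Y := Y) f (𝟙 A) c ∧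
      ∃ M : MappingCone n f, s (push E X.inf (pull E Y.γ.hom ρ)) = ⟦M.seq⟧
  /-- (EA2) in the opposite category: `(a, 1)` has a lift whose mapping cocone realizes
  `(dⁿ_Y)^* ρ` -/
  good_lift_op : ∀ {A B C : 𝓒} (ρ : Ext E C A) (a : A ⟶ B) (X : NSeq n A C) (Y : NSeq n B C),
    s ρ = ⟦X⟧ → s (push E a ρ) = ⟦Y⟧ →
    ∃ h : X.K ⟶ Y.K, NSeq.Lifts (X := X) (Y := Y) h a (𝟙 C) ∧
      ∃ N : MappingCocone n h, s (push E X.α.inv (pull E Y.defl ρ)) = ⟦N.seq⟧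

/-! ## Additive subfunctors of `𝔼` -/

/-- An additive sub-bifunctor of `E`. -/
structure AddSubBifunctor (E : 𝓒ᵒᵖ ⥤ 𝓒 ⥤ AddCommGrpCat.{w}) where
  /-- the subgroups -/
  grp : ∀ C A : 𝓒, AddSubgroup (Ext E C A)
  push_mem : ∀ {C A A' : 𝓒} (a : A ⟶ A') (δ : Ext E C A), δ ∈ grp C A → push E a δ ∈ grp C A'
  pull_mem : ∀ {C C' A : 𝓒} (c : C' ⟶ C) (δ : Ext E C A), δ ∈ grp C A → pull E c δ ∈ grp C' A

namespace AddSubBifunctor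

variable {E : 𝓒ᵒᵖ ⥤ 𝓒 ⥤ AddCommGrpCat.{w}} (F : AddSubBifunctor E)

/-- The bifunctor given by the subgroups. -/
def toBifunctor : 𝓒ᵒᵖ ⥤ 𝓒 ⥤ AddCommGrpCat.{w} where
  obj C :=
    { obj := fun A => AddCommGrpCat.of (F.grp C.unop A)
      map := fun {A A'} a => AddCommGrpCat.ofHom
        ((((E.obj C).map a).hom.comp (F.grp C.unop A).subtype).codRestrict (F.grp C.unop A')
          (fun δ => F.push_mem a δ.1 δ.2))
      map_id := fun A => by ext δ; simp
      map_comp := fun a b => by ext δ; simp; rfl }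
  map {C C'} c :=
    { app := fun A => AddCommGrpCat.ofHom
        ((((E.map c).app A).hom.comp (F.grp C.unop A).subtype).codRestrict (F.grp C'.unop A)
          (fun δ => F.pull_mem c.unop δ.1 δ.2))
      naturality := fun A A' a => by
        ext δ
        exact NatTrans.naturality_apply (E.map c) a δ.1 }
  map_id C := by ext A δ; simp
  map_comp c c' := by ext A δ; simp; rfl

/-- The restriction of `s` to the subfunctor. -/
def restrict {n : ℕ} (s : Corr n E) : Corr n F.toBifunctor :=
  fun A C (δ : F.grp C A) => s δ.1

end AddSubBifunctor

/-! ## Classes of distinguished `n`-exangles and `n`-proper classes -/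

/-- A class of pairs `⟨X, δ⟩`. -/
abbrev ExangleClass (n : ℕ) (E : 𝓒ᵒᵖ ⥤ 𝓒 ⥤ AddCommGrpCat.{w}) :=
  ∀ ⦃A C : 𝓒⦄, NSeq n A C → Ext E C A → Prop

section Proper

variable {n : ℕ} {E : 𝓒ᵒᵖ ⥤ 𝓒 ⥤ AddCommGrpCat.{w}}

/-- The sequences that underlie a member of `ξ`. -/
def ExangleClass.seqs (ξ : ExangleClass n E) : SeqClass 𝓒 n := fun _ _ X => ∃ δ, ξ X δ

/-- `ξ` is closed under weak isomorphisms, that is, under morphisms `f` of distinguished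
`n`-exangles such that `f⁰` and `fⁿ⁺¹` are isomorphisms. -/
def ClosedUnderWeakIso (s : Corr n E) (ξ : ExangleClass n E) : Prop :=
  ∀ {A C A' C' : 𝓒} (X : NSeq n A C) (δ : Ext E C A) (Y : NSeq n A' C') (ρ : Ext E C' A'),
    s δ = ⟦X⟧ → s ρ = ⟦Y⟧ →
    ∀ (f : X.K ⟶ Y.K) (a : A ⟶ A') (c : C ⟶ C'), NSeq.Lifts (X := X) (Y := Y) f a c →
      push E a δ = pull E c ρ → IsIso a → IsIso c → (ξ X δ ↔ ξ Y ρ)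

/-- `ξ` is an `n`-proper class of distinguished `n`-exangles of `(𝓒, E, s)`. -/
structure IsNProper [HasBinaryBiproducts 𝓒] (s : Corr n E) (ξ : ExangleClass n E) : Prop where
  distinguished : ∀ {A C : 𝓒} (X : NSeq n A C) (δ : Ext E C A), ξ X δ → s δ = ⟦X⟧
  split_mem : ∀ {A C : 𝓒} (X : NSeq n A C), s (0 : Ext E C A) = ⟦X⟧ → ξ X (0 : Ext E C A)
  weakIso : ClosedUnderWeakIso s ξ
  sum_mem : ∀ {A C A' C' : 𝓒} (X : NSeq n A C) (δ : Ext E C A) (Y : NSeq n A' C')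
    (ρ : Ext E C' A'), ξ X δ → ξ Y ρ → ξ (X.sum Y) (extSum E δ ρ)
  base_change : ∀ {A C C' : 𝓒} (X : NSeq n A C) (δ : Ext E C A) (c : C' ⟶ C) (Y : NSeq n A C'),
    ξ X δ → s (pull E c δ) = ⟦Y⟧ → ξ Y (pull E c δ)
  cobase_change : ∀ {A A' C : 𝓒} (X : NSeq n A C) (δ : Ext E C A) (a : A ⟶ A') (Y : NSeq n A' C),
    ξ X δ → s (push E a δ) = ⟦Y⟧ → ξ Y (push E a δ)
  saturated : ∀ {A B C D : 𝓒} (a : A ⟶ B) (b : B ⟶ D) (c : A ⟶ C) (d : C ⟶ D), a ≫ b = c ≫ d →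
    IsDeflation (Conf s) a → IsDeflation (Conf s) b → IsDeflation (Conf s) d →
    IsDeflation ξ.seqs a → IsDeflation ξ.seqs b → IsDeflation ξ.seqs d

/-- The subfunctor `F` is `E_ξ`: its elements are the extensions that are realized by a member
of `ξ`. -/
def IsSubfunctorOf (ξ : ExangleClass n E) (F : AddSubBifunctor E) : Prop :=
  ∀ (A C : 𝓒) (δ : Ext E C A), δ ∈ F.grp C A ↔ ∃ X : NSeq n A C, ξ X δ

/-- `(𝓒, E_ξ, s_ξ)` is an `n`-exangulated category. In particular `E_ξ` is an additive
sub-bifunctor of `E`. -/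
def RestrictionIsNExangulated [HasBinaryBiproducts 𝓒] (s : Corr n E) (ξ : ExangleClass n E) :
    Prop :=
  ∃ F : AddSubBifunctor E, IsSubfunctorOf ξ F ∧ IsNExangulated n F.toBifunctor (F.restrict s)

end Proper

/-! ## `n`-exact categories -/

section NExact

variable {n : ℕ}

/-- `(d⁰, …, dⁿ⁻¹)` is an `n`-kernel of `dⁿ`. -/
structure LeftNExact {A C : 𝓒} (X : NSeq n A C) : Prop where
  mono : Mono X.inf
  exact : CovExact n X.K

/-- `(d¹, …, dⁿ)` is an `n`-cokernel of `d⁰`. -/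
structure RightNExact {A C : 𝓒} (X : NSeq n A C) : Prop where
  epi : Epi X.defl
  exact : ContraExact n X.K

/-- `X` is an `n`-exact sequence. -/
def IsNExactSeq {A C : 𝓒} (X : NSeq n A C) : Prop := LeftNExact X ∧ RightNExact X

/-- Weak isomorphisms of `n`-exact sequences in the sense of Jasso: two cyclically consecutive
components are isomorphisms. -/
def JassoWeakIso {A C A' C' : 𝓒} {X : NSeq n A C} {Y : NSeq n A' C'} (f : X.K ⟶ Y.K) : Prop :=
  (∃ k, k ≤ n ∧ IsIso (f.f k) ∧ IsIso (f.f (k + 1))) ∨ (IsIso (f.f (n + 1)) ∧ IsIso (f.f 0))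

/-- The class `𝒳` of admissible sequences makes `𝓒` an `n`-exact category (Jasso). -/
structure IsNExactStructure [HasBinaryBiproducts 𝓒] (𝒳 : SeqClass 𝓒 n) : Prop where
  nExact : ∀ {A C : 𝓒} (X : NSeq n A C), 𝒳 X → IsNExactSeq X
  weakIso : ∀ {A C A' C' : 𝓒} (X : NSeq n A C) (Y : NSeq n A' C'), IsNExactSeq X → IsNExactSeq Y →
    ∀ f : X.K ⟶ Y.K, JassoWeakIso (X := X) (Y := Y) f → (𝒳 X ↔ 𝒳 Y)
  /-- (E0) the zero sequence is admissible -/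
  zero : ∀ {A C : 𝓒} (X : NSeq n A C), (∀ i, IsZero (X.K.X i)) → 𝒳 X
  /-- (E1) -/
  mono_comp : ∀ {A B C : 𝓒} (f : A ⟶ B) (g : B ⟶ C),
    IsInflation 𝒳 f → IsInflation 𝒳 g → IsInflation 𝒳 (f ≫ g)
  epi_comp : ∀ {A B C : 𝓒} (f : A ⟶ B) (g : B ⟶ C),
    IsDeflation 𝒳 f → IsDeflation 𝒳 g → IsDeflation 𝒳 (f ≫ g)
  /-- (E2) there is an `n`-pushout `L⁰ ⟶ ⋯ ⟶ Lⁿ` of `X⁰ ⟶ ⋯ ⟶ Xⁿ` along `f` whose first morphism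
  is an admissible monomorphism. Only the degrees `0, …, n` of `L` enter. -/
  pushout : ∀ {A C : 𝓒} (X : NSeq n A C), 𝒳 X → ∀ (B : 𝓒) (f : A ⟶ B),
    ∃ (L : CochainComplex 𝓒 ℕ) (φ : X.K ⟶ L) (e : L.X 0 ≅ B) (N : MappingCocone n φ),
      φ.f 0 ≫ e.hom = X.α.hom ≫ f ∧ RightNExact N.seq ∧ IsInflation 𝒳 (e.inv ≫ L.d 0 1)
  /-- (E2), dual: there is an `n`-pullback `L¹ ⟶ ⋯ ⟶ Lⁿ⁺¹` of `X¹ ⟶ ⋯ ⟶ Xⁿ⁺¹` along `g` whose last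
  morphism is an admissible epimorphism. Only the degrees `1, …, n + 1` of `L` enter. -/
  pullback : ∀ {A C : 𝓒} (X : NSeq n A C), 𝒳 X → ∀ (B : 𝓒) (g : B ⟶ C),
    ∃ (L : CochainComplex 𝓒 ℕ) (φ : L ⟶ X.K) (e : L.X (n + 1) ≅ B) (M : MappingCone n φ),
      φ.f (n + 1) ≫ X.γ.hom = e.hom ≫ g ∧ LeftNExact M.seq ∧
        IsDeflation 𝒳 (L.d n (n + 1) ≫ e.hom)

/-- The `n`-exangulated category `(𝓒, E, s)` is an `n`-exact category: its conflations are the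
admissible sequences of an `n`-exact structure, and `E(C, A)` is, through `s`, the set of homotopy
classes of admissible sequences from `A` to `C`. (The bifunctor `E` is then determined by the
`n`-exact structure: `a_*` and `c^*` are given by `n`-pushouts and `n`-pullbacks because of (R0),
and the addition is the Baer sum because `E` is additive.) -/
structure IsNExact [HasBinaryBiproducts 𝓒] (n : ℕ) (E : 𝓒ᵒᵖ ⥤ 𝓒 ⥤ AddCommGrpCat.{w})
    (s : Corr n E) : Prop where
  exangulated : IsNExangulated n E s
  nExact : IsNExactStructure (Conf s)
  injective : ∀ A C : 𝓒, Function.Injective (fun δ : Ext E C A => s δ)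

/-- The class of distinguished `n`-exangles that is induced by a class of sequences. -/
def inducedClass {E : 𝓒ᵒᵖ ⥤ 𝓒 ⥤ AddCommGrpCat.{w}} (s : Corr n E) (ξ : SeqClass 𝓒 n) :
    ExangleClass n E :=
  fun _ _ X δ => s δ = ⟦X⟧ ∧ ξ X

/-- `(𝓒, E_ξ, s_ξ)` is an `n`-exact category. -/
def RestrictionIsNExact [HasBinaryBiproducts 𝓒] {E : 𝓒ᵒᵖ ⥤ 𝓒 ⥤ AddCommGrpCat.{w}}
    (s : Corr n E) (ξ : ExangleClass n E) : Prop :=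
  ∃ F : AddSubBifunctor E, IsSubfunctorOf ξ F ∧ IsNExact n F.toBifunctor (F.restrict s)

end NExact

/-! ## `(n + 2)`-angulated categories -/

/-- An `(n + 2)`-`Σ`-sequence `X⁰ ⟶ X¹ ⟶ ⋯ ⟶ Xⁿ⁺¹ ⟶ Σ X⁰`. -/
structure SigmaSeq (n : ℕ) (S : 𝓒 ⥤ 𝓒) where
  /-- the objects -/
  X : Fin (n + 2) → 𝓒
  /-- the morphisms `Xⁱ ⟶ Xⁱ⁺¹` -/
  d : ∀ i : Fin (n + 1), X i.castSucc ⟶ X i.succ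
  /-- the morphism `Xⁿ⁺¹ ⟶ Σ X⁰` -/
  w : X (Fin.last (n + 1)) ⟶ S.obj (X 0)

namespace SigmaSeq

variable {n : ℕ} {S : 𝓒 ⥤ 𝓒}

/-- Morphisms of `Σ`-sequences. -/
structure Hom (T T' : SigmaSeq n S) where
  /-- the components -/
  f : ∀ i : Fin (n + 2), T.X i ⟶ T'.X i
  comm : ∀ i : Fin (n + 1), T.d i ≫ f i.succ = f i.castSucc ≫ T'.d i
  comm_w : T.w ≫ S.map (f 0) = f (Fin.last (n + 1)) ≫ T'.w

/-- The direct sum of two `Σ`-sequences. -/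
noncomputable def sum [HasBinaryBiproducts 𝓒] (T T' : SigmaSeq n S) : SigmaSeq n S where
  X i := T.X i ⊞ T'.X i
  d i := biprod.map (T.d i) (T'.d i)
  w := biprod.desc (T.w ≫ S.map biprod.inl) (T'.w ≫ S.map biprod.inr)

/-- `R` is (isomorphic to) the left rotation
`X¹ ⟶ X² ⟶ ⋯ ⟶ Xⁿ⁺¹ ⟶ Σ X⁰ ⟶ Σ X¹` of `T`, with the last morphism `(-1)ⁿ Σ d⁰`. -/
structure LeftRotation (T R : SigmaSeq n S) where
  /-- the terms in the degrees `0, …, n` -/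
  e : ∀ i : Fin (n + 1), R.X i.castSucc ≅ T.X i.succ
  /-- the term in the degree `n + 1` -/
  eLast : R.X (Fin.last (n + 1)) ≅ S.obj (T.X 0)
  comm : ∀ i : Fin n, R.d i.castSucc ≫ (e i.succ).hom = (e i.castSucc).hom ≫ T.d i.succ
  comm_last : R.d (Fin.last n) ≫ eLast.hom = (e (Fin.last n)).hom ≫ T.w
  comm_w : R.w ≫ S.map (e 0).hom = eLast.hom ≫ ((-1 : ℤ) ^ n • S.map (T.d 0))

/-- `M` is (isomorphic to) the mapping cone
`X¹ ⊕ Y⁰ ⟶ X² ⊕ Y¹ ⟶ ⋯ ⟶ Σ X⁰ ⊕ Yⁿ⁺¹ ⟶ Σ X¹ ⊕ Σ Y⁰`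
of `φ`, with the differentials `(-d 0 ; φ d)`. -/
structure Cone [HasBinaryBiproducts 𝓒] {T T' : SigmaSeq n S} (φ : Hom T T')
    (M : SigmaSeq n S) where
  /-- the terms in the degrees `0, …, n` -/
  e : ∀ i : Fin (n + 1), M.X i.castSucc ≅ T.X i.succ ⊞ T'.X i.castSucc
  /-- the term in the degree `n + 1` -/
  eLast : M.X (Fin.last (n + 1)) ≅ S.obj (T.X 0) ⊞ T'.X (Fin.last (n + 1))
  comm : ∀ i : Fin n, M.d i.castSucc ≫ (e i.succ).hom =
    (e i.castSucc).hom ≫ biprod.desc (biprod.lift (-T.d i.succ) (φ.f i.succ.castSucc))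
      (biprod.lift 0 (T'.d i.castSucc))
  comm_last : M.d (Fin.last n) ≫ eLast.hom =
    (e (Fin.last n)).hom ≫ biprod.desc (biprod.lift (-T.w) (φ.f (Fin.last (n + 1))))
      (biprod.lift 0 (T'.d (Fin.last n)))
  comm_w_fst : M.w ≫ S.map ((e 0).hom ≫ biprod.fst) = eLast.hom ≫ biprod.fst ≫ (-S.map (T.d 0))
  comm_w_snd : M.w ≫ S.map ((e 0).hom ≫ biprod.snd) =
    eLast.hom ≫ biprod.desc (S.map (φ.f 0)) T'.w

end SigmaSeq

/-- The class `Θ` makes `(𝓒, Σ)` an `(n + 2)`-angulated category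
(Geiss, Keller and Oppermann). -/
structure IsAngulated [HasBinaryBiproducts 𝓒] (n : ℕ) (S : 𝓒 ⥤ 𝓒) (Θ : SigmaSeq n S → Prop) :
    Prop where
  iso_mem : ∀ (T T' : SigmaSeq n S) (φ : SigmaSeq.Hom T T'), (∀ i, IsIso (φ.f i)) → Θ T → Θ T'
  /-- (F1) (a) closure under direct sums and direct summands -/
  sum_mem : ∀ T T' : SigmaSeq n S, Θ T → Θ T' → Θ (T.sum T')
  summand_mem : ∀ T T' : SigmaSeq n S, Θ (T.sum T') → Θ T
  /-- (F1) (b) the trivial sequences `X = X ⟶ 0 ⟶ ⋯ ⟶ 0 ⟶ Σ X` -/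
  trivial_mem : ∀ T : SigmaSeq n S, IsIso (T.d 0) → (∀ i : Fin n, IsZero (T.X i.succ.succ)) → Θ T
  /-- (F1) (c) each morphism is the first morphism of an `(n + 2)`-angle -/
  exists_angle : ∀ {A B : 𝓒} (f : A ⟶ B), ∃ T : SigmaSeq n S, Θ T ∧
    ∃ (e₀ : T.X (Fin.castSucc 0) ≅ A) (e₁ : T.X (Fin.succ 0) ≅ B), T.d 0 ≫ e₁.hom = e₀.hom ≫ f
  /-- (F2) -/
  rotate : ∀ T R : SigmaSeq n S, Nonempty (SigmaSeq.LeftRotation T R) → (Θ T ↔ Θ R)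
  /-- (F3) and (F4): a commutative square on the first two terms can be completed to a morphism
  whose mapping cone is an `(n + 2)`-angle -/
  complete : ∀ T T' : SigmaSeq n S, Θ T → Θ T' →
    ∀ (a : T.X (Fin.castSucc 0) ⟶ T'.X (Fin.castSucc 0)) (b : T.X (Fin.succ 0) ⟶ T'.X (Fin.succ 0)),
    T.d 0 ≫ b = a ≫ T'.d 0 →
    ∃ φ : SigmaSeq.Hom T T', φ.f (Fin.castSucc 0) = a ∧ φ.f (Fin.succ 0) = b ∧
      ∃ M : SigmaSeq n S, Nonempty (SigmaSeq.Cone φ M) ∧ Θ M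

/-- The `Σ`-sequence `A ⟶ X¹ ⟶ ⋯ ⟶ Xⁿ ⟶ C ⟶ Σ A` given by a sequence and a morphism
`C ⟶ Σ A`. -/
def NSeq.toSigma {n : ℕ} {S : 𝓒 ⥤ 𝓒} {A C : 𝓒} (X : NSeq n A C) (δ : C ⟶ S.obj A) :
    SigmaSeq n S where
  X i := X.K.X i.val
  d i := X.K.d i.val (i.val + 1)
  w := X.γ.hom ≫ δ ≫ S.map X.α.inv

/-- A presentation of `(𝓒, E, s)` as an `(n + 2)`-angulated category: an autoequivalence `Σ` and a
class `Θ` of `(n + 2)`-angles, together with a natural isomorphism `E(C, A) ≅ 𝓒(C, Σ A)` under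
which the distinguished `n`-exangles are the `(n + 2)`-angles. -/
structure AngulatedPresentation [HasBinaryBiproducts 𝓒] (n : ℕ)
    (E : 𝓒ᵒᵖ ⥤ 𝓒 ⥤ AddCommGrpCat.{w}) (s : Corr n E) where
  /-- the suspension -/
  S : 𝓒 ⥤ 𝓒
  isEquivalence : S.IsEquivalence
  additive : S.Additive
  /-- the class of `(n + 2)`-angles -/
  Θ : SigmaSeq n S → Prop
  isAngulated : IsAngulated n S Θ
  /-- the isomorphism `E(C, A) ≅ 𝓒(C, Σ A)` -/
  φ : ∀ C A : 𝓒, Ext E C A ≃+ (C ⟶ S.obj A)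
  φ_push : ∀ {C A A' : 𝓒} (a : A ⟶ A') (δ : Ext E C A), φ C A' (push E a δ) = φ C A δ ≫ S.map a
  φ_pull : ∀ {C C' A : 𝓒} (c : C' ⟶ C) (δ : Ext E C A), φ C' A (pull E c δ) = c ≫ φ C A δ
  distinguished_iff : ∀ {A C : 𝓒} (X : NSeq n A C) (δ : Ext E C A),
    s δ = ⟦X⟧ ↔ Θ (X.toSigma (φ C A δ))

/-- The class of distinguished `n`-exangles that is induced by a class of `(n + 2)`-angles. -/
def AngulatedPresentation.inducedClass [HasBinaryBiproducts 𝓒] {n : ℕ}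
    {E : 𝓒ᵒᵖ ⥤ 𝓒 ⥤ AddCommGrpCat.{w}} {s : Corr n E} (P : AngulatedPresentation n E s)
    (ξ : SigmaSeq n P.S → Prop) : ExangleClass n E :=
  fun _ C X δ => s δ = ⟦X⟧ ∧ ξ (X.toSigma (P.φ C _ δ))

end NExang

/-!
Write `F = E_ξ`. Closure under weak isomorphisms makes `ξ` the class of all distinguished
`n`-exangles whose extension lies in `F`, so that `ξ` and `F` determine each other, and the point is
to compare saturation with (EA1). The link is the exactness of `𝓒(A, B) ⟶ E(C, B) ⟶ E(Xⁿ, B)` at a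
distinguished `n`-exangle `⟨X, δ⟩`, and its dual: an extension that is annihilated by an
`F`-deflation is of the form `a_* δ` with `δ ∈ F`, hence lies in `F`.

If `a ≫ b = c ≫ d` as in the definition of saturation, then `a ≫ b` annihilates the extension which
`d` belongs to; so composability of `F`-deflations implies saturation, and the converse is
saturation for `c = 𝟙`. That `F`-inflations compose follows from the same exact sequences.

For `n`-exact categories it remains to see that Jasso's weak isomorphisms respect membership in `F`.
Two consecutive isomorphisms make a morphism `f : X ⟶ Y` of `n`-exact sequences a split
monomorphism in degree `0` and a split epimorphism in degree `n + 1`, up to homotopy, so each of the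
two extensions is obtained from the other by a base change and a cobase change.
-/

namespace NExang

section Extensions

variable {𝓒 : Type u} [Category.{v} 𝓒] {E : 𝓒ᵒᵖ ⥤ 𝓒 ⥤ AddCommGrpCat.{w}}

@[simp]
theorem push_id {A C : 𝓒} (δ : Ext E C A) : push E (𝟙 A) δ = δ := by
  simp [push]

@[simp]
theorem pull_id {A C : 𝓒} (δ : Ext E C A) : pull E (𝟙 C) δ = δ := by
  simp [pull]

theorem push_comp {A A' A'' C : 𝓒} (a : A ⟶ A') (b : A' ⟶ A'') (δ : Ext E C A) :
    push E (a ≫ b) δ = push E b (push E a δ) := by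
  simp [push]

theorem pull_comp {A C C' C'' : 𝓒} (c : C'' ⟶ C') (d : C' ⟶ C) (δ : Ext E C A) :
    pull E (c ≫ d) δ = pull E c (pull E d δ) := by
  simp [pull]

@[simp]
theorem push_zero {A A' C : 𝓒} (a : A ⟶ A') : push E a (0 : Ext E C A) = 0 :=
  map_zero ((E.obj (op C)).map a).hom

@[simp]
theorem pull_zero {A C C' : 𝓒} (c : C' ⟶ C) : pull E c (0 : Ext E C A) = 0 :=
  map_zero ((E.map c.op).app A).hom

@[simp]
theorem push_add {A A' C : 𝓒} (a : A ⟶ A') (δ δ' : Ext E C A) :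
    push E a (δ + δ') = push E a δ + push E a δ' :=
  map_add ((E.obj (op C)).map a).hom δ δ'

@[simp]
theorem pull_add {A C C' : 𝓒} (c : C' ⟶ C) (δ δ' : Ext E C A) :
    pull E c (δ + δ') = pull E c δ + pull E c δ' :=
  map_add ((E.map c.op).app A).hom δ δ'

theorem push_pull {A A' C C' : 𝓒} (a : A ⟶ A') (c : C' ⟶ C) (δ : Ext E C A) :
    push E a (pull E c δ) = pull E c (push E a δ) :=
  (NatTrans.naturality_apply (E.map c.op) a δ).symm

variable [Preadditive 𝓒]

theorem add_push {C : 𝓒} [(E.obj (op C)).Additive] {A A' : 𝓒} (a b : A ⟶ A') (δ : Ext E C A) :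
    push E (a + b) δ = push E a δ + push E b δ := by
  simp [push, Functor.map_add]

theorem add_pull [E.Additive] {A C C' : 𝓒} (c d : C' ⟶ C) (δ : Ext E C A) :
    pull E (c + d) δ = pull E c δ + pull E d δ := by
  simp [pull, Functor.map_add]

theorem neg_push {C : 𝓒} [(E.obj (op C)).Additive] {A A' : 𝓒} (a : A ⟶ A') (δ : Ext E C A) :
    push E (-a) δ = -push E a δ := by
  simp [push, Functor.map_neg]

theorem zero_push {C : 𝓒} [(E.obj (op C)).Additive] {A A' : 𝓒} (δ : Ext E C A) :
    push E (0 : A ⟶ A') δ = 0 := by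
  simp [push]

theorem zero_pull [E.Additive] {A C C' : 𝓒} (δ : Ext E C A) :
    pull E (0 : C' ⟶ C) δ = 0 := by
  simp [pull]

theorem pull_lift_push_desc_extSum [HasBinaryBiproducts 𝓒] {A C : 𝓒} (δ δ' : Ext E C A) :
    pull E (biprod.lift (𝟙 C) (𝟙 C)) (push E (biprod.desc (𝟙 A) (𝟙 A)) (extSum E δ δ')) =
      δ + δ' := by
  simp only [extSum, pull_add, push_add, push_pull, ← pull_comp, biprod.lift_fst,
    biprod.lift_snd, pull_id, ← push_comp, biprod.inl_desc, biprod.inr_desc, push_id]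

end Extensions

section ExactSequences

variable {𝓒 : Type u} [Category.{v} 𝓒] [Preadditive 𝓒] {E : 𝓒ᵒᵖ ⥤ 𝓒 ⥤ AddCommGrpCat.{w}} {n : ℕ}

section Exangle

variable {A B C : 𝓒} {X : NSeq n A C} {δ : Ext E C A}

theorem IsExangle.push_inf (h : IsExangle E X δ) : push E X.inf δ = 0 :=
  (h.contra_last _ _).2 ⟨𝟙 _, Category.comp_id _⟩

theorem IsExangle.pull_defl (h : IsExangle E X δ) : pull E X.defl δ = 0 :=
  (h.cov_last _ _).2 ⟨𝟙 _, Category.id_comp _⟩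

theorem IsExangle.push_push_eq_self [(E.obj (op C)).Additive] (h : IsExangle E X δ) {a : A ⟶ B}
    {b : B ⟶ A} {t : X.K.X 1 ⟶ A} (e : a ≫ b + X.inf ≫ t = 𝟙 A) :
    push E b (push E a δ) = δ :=
  calc
    push E b (push E a δ) = push E (a ≫ b + X.inf ≫ t) δ := by
      simp [add_push, push_comp, h.push_inf]
    _ = δ := by rw [e, push_id]

theorem IsExangle.pull_pull_eq_self [E.Additive] (h : IsExangle E X δ) {c : B ⟶ C}
    {b : C ⟶ B} {t : C ⟶ X.K.X n} (e : b ≫ c + t ≫ X.defl = 𝟙 C) :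
    pull E b (pull E c δ) = δ :=
  calc
    pull E b (pull E c δ) = pull E (b ≫ c + t ≫ X.defl) δ := by
      simp [add_pull, pull_comp, h.pull_defl]
    _ = δ := by rw [e, pull_id]

end Exangle

theorem exists_realization (s : Corr n E) {A C : 𝓒} (δ : Ext E C A) : ∃ X : NSeq n A C, s δ = ⟦X⟧ :=
  let ⟨X, hX⟩ := Quotient.exists_rep (s δ)
  ⟨X, hX.symm⟩

variable [HasBinaryBiproducts 𝓒]

theorem MappingCocone.exists_inf_comp_eq {K L : CochainComplex 𝓒 ℕ} {f : K ⟶ L}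
    (N : MappingCocone n f) (hn : 1 ≤ n) {W : 𝓒} (k : N.seq.K.X 1 ⟶ W) :
    ∃ (u : K.X 1 ⟶ W) (v : L.X 0 ⟶ W), N.seq.inf ≫ k = f.f 0 ≫ v + K.d 0 1 ≫ u := by
  let e := N.e 0 1 rfl hn
  refine ⟨biprod.inl ≫ e.inv ≫ k, biprod.inr ≫ e.inv ≫ k, ?_⟩
  rw [← Iso.hom_inv_id_assoc e k, reassoc_of% N.inf_comm hn, biprod.lift_eq]
  simp [add_comm]

theorem MappingCone.exists_comp_defl_eq {K L : CochainComplex 𝓒 ℕ} {f : K ⟶ L}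
    (M : MappingCone n f) (hn : 1 ≤ n) {W : 𝓒} (k : W ⟶ M.seq.K.X n) :
    ∃ (u : W ⟶ L.X n) (v : W ⟶ K.X (n + 1)),
      k ≫ M.seq.defl = v ≫ f.f (n + 1) + u ≫ L.d n (n + 1) := by
  let e := M.e n hn le_rfl
  refine ⟨k ≫ e.hom ≫ biprod.snd, k ≫ e.hom ≫ biprod.fst, ?_⟩
  rw [M.defl_comm hn, biprod.desc_eq]
  simp [e]

namespace IsNExangulated

variable {s : Corr n E} (h : IsNExangulated n E s) (hn : 1 ≤ n)

include h hn

theorem exists_push_push_eq_self {A B C : 𝓒} {δ : Ext E C A} {a : A ⟶ B} {Y : NSeq n B C}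
    (hY : s (push E a δ) = ⟦Y⟧) (hδ : pull E Y.defl δ = 0) :
    ∃ b : B ⟶ A, push E b (push E a δ) = δ := by
  have := h.additive_right
  obtain ⟨X, hX⟩ := exists_realization s δ
  obtain ⟨f, hf, N, hN⟩ := h.good_lift_op δ a X Y hX hY
  obtain ⟨k, hk⟩ := ((h.exangle _ _ hN).contra_last _ X.α.hom).1 (by simp [hδ])
  obtain ⟨u, v, huv⟩ := N.exists_inf_comp_eq hn k
  have ha : a ≫ Y.α.inv = X.α.inv ≫ f.f 0 := by
    rw [Iso.eq_inv_comp, ← Category.assoc, ← hf.left, Category.assoc, Iso.hom_inv_id,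
      Category.comp_id]
  refine ⟨Y.α.inv ≫ v, (h.exangle δ X hX).push_push_eq_self (t := u) ?_⟩
  rw [reassoc_of% ha, NSeq.inf, Category.assoc, ← Preadditive.comp_add, ← huv, hk,
    Iso.inv_hom_id]

theorem exists_pull_pull_eq_self {A B C : 𝓒} {δ : Ext E C A} {c : B ⟶ C} {X : NSeq n A B}
    (hX : s (pull E c δ) = ⟦X⟧) (hδ : push E X.inf δ = 0) :
    ∃ b : C ⟶ B, pull E b (pull E c δ) = δ := by
  have := h.additive_left
  obtain ⟨Y, hY⟩ := exists_realization s δ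
  obtain ⟨f, hf, M, hM⟩ := h.good_lift δ c X Y hX hY
  obtain ⟨k, hk⟩ := ((h.exangle _ _ hM).cov_last _ Y.γ.inv).1 (by
    rw [← push_pull, ← pull_comp, Iso.inv_hom_id, pull_id, hδ])
  obtain ⟨u, v, huv⟩ := M.exists_comp_defl_eq hn k
  refine ⟨v ≫ X.γ.hom, (h.exangle δ Y hY).pull_pull_eq_self (t := u) ?_⟩
  rw [Category.assoc, ← hf.right, NSeq.defl, ← Category.assoc, ← Category.assoc,
    ← Preadditive.add_comp, ← huv, hk, Iso.inv_hom_id]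

theorem exists_push_eq {A B C : 𝓒} {δ : Ext E C A} {X : NSeq n A C} (hX : s δ = ⟦X⟧)
    {ρ : Ext E C B} (hρ : pull E X.defl ρ = 0) : ∃ a : A ⟶ B, push E a δ = ρ := by
  have := h.additive_right
  let θ : Ext E C (A ⊞ B) := push E biprod.inl δ + push E biprod.inr ρ
  have hfst : push E biprod.fst θ = δ := by simp [θ, ← push_comp, zero_push]
  have hsnd : push E biprod.snd θ = ρ := by simp [θ, ← push_comp, zero_push]
  have hθ : pull E X.defl θ = 0 := by
    simp [θ, ← push_pull, (h.exangle δ X hX).pull_defl, hρ]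
  obtain ⟨b, hb⟩ := h.exists_push_push_eq_self hn (hfst ▸ hX) hθ
  exact ⟨b ≫ biprod.snd, by rw [push_comp, ← hsnd, ← hb, hfst]⟩

theorem exists_pull_eq {A C W : 𝓒} {δ : Ext E C A} {X : NSeq n A C} (hX : s δ = ⟦X⟧)
    {τ : Ext E W A} (hτ : push E X.inf τ = 0) : ∃ c : W ⟶ C, pull E c δ = τ := by
  have := h.additive_left
  let θ : Ext E (C ⊞ W) A := pull E biprod.fst δ + pull E biprod.snd τ
  have hinl : pull E biprod.inl θ = δ := by simp [θ, ← pull_comp, zero_pull]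
  have hinr : pull E biprod.inr θ = τ := by simp [θ, ← pull_comp, zero_pull]
  have hθ : push E X.inf θ = 0 := by
    simp [θ, push_pull, (h.exangle δ X hX).push_inf, hτ]
  obtain ⟨b, hb⟩ := h.exists_pull_pull_eq_self hn (hinl ▸ hX) hθ
  exact ⟨biprod.inr ≫ b, by rw [pull_comp, ← hinr, ← hb, hinl]⟩

end IsNExangulated

end ExactSequences

section Homotopy

variable {𝓒 : Type u} [Category.{v} 𝓒] [Preadditive 𝓒] {n : ℕ} {K L : CochainComplex 𝓒 ℕ}

theorem exists_homotopy_sub (u : K ⟶ L) (m : ℕ) (k : K.X (m + 1) ⟶ L.X m) :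
    ∃ w : K ⟶ L, Nonempty (Homotopy u w) ∧ (∀ i < m, w.f i = u.f i) ∧
      w.f m = u.f m - K.d m (m + 1) ≫ k := by
  let H : ∀ i : ℕ, K.X (i + 1) ⟶ L.X i := Function.update 0 m k
  let N : K ⟶ L := Homotopy.nullHomotopicMap' fun i j hij => by
    obtain rfl : j + 1 = i := hij
    exact H j
  have hN : ∀ i ≤ m, N.f i = K.d i (i + 1) ≫ H i := by
    rintro (_ | i) hi
    · exact Homotopy.nullHomotopicMap'_f_of_not_rel_right (k₀ := 1) rfl (by simp) _
    · have hH : H i = 0 := by simp [H, (Nat.lt_of_succ_le hi).ne]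
      rw [Homotopy.nullHomotopicMap'_f (k₂ := i) (k₁ := i + 1) (k₀ := i + 2) rfl rfl]
      simp [hH]
  refine ⟨u - N, ⟨Homotopy.equivSubZero.symm
    ((Homotopy.ofEq (sub_sub_cancel u N)).trans (Homotopy.nullHomotopy' _))⟩, fun i hi => ?_, ?_⟩
  · simp [hN i hi.le, H, hi.ne]
  · simp [hN m le_rfl, H]

theorem ContraExact.exists_homotopy_vanishing (hK : ContraExact n K) (u : K ⟶ L)
    (h0 : u.f 0 = 0) : ∃ w : K ⟶ L, Nonempty (Homotopy u w) ∧ ∀ i ≤ n, w.f i = 0 := by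
  have key : ∀ m ≤ n, ∃ w : K ⟶ L, Nonempty (Homotopy u w) ∧ ∀ i ≤ m, w.f i = 0 := by
    intro m
    induction m with
    | zero =>
      exact fun _ => ⟨u, ⟨Homotopy.refl u⟩, fun i hi => by rwa [Nat.le_zero.1 hi]⟩
    | succ m ih =>
      intro hm
      obtain ⟨w, ⟨huw⟩, hw⟩ := ih (Nat.le_of_succ_le hm)
      obtain ⟨k, hk⟩ := hK _ m hm (w.f (m + 1)) (by rw [← w.comm, hw m le_rfl, zero_comp])
      obtain ⟨w', ⟨hww'⟩, hlt, heq⟩ := exists_homotopy_sub w (m + 1) k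
      refine ⟨w', ⟨huw.trans hww'⟩, fun i hi => ?_⟩
      rcases hi.lt_or_eq with hi | rfl
      · rw [hlt i hi, hw i (Nat.le_of_lt_succ hi)]
      · rw [heq, hk, sub_self]
  exact key n le_rfl

theorem f_succ_eq_of_homotopy {u w : K ⟶ L} (H : Homotopy u w) {m : ℕ}
    (hd : K.d (m + 1) (m + 2) = 0) :
    u.f (m + 1) = H.hom (m + 1) m ≫ L.d m (m + 1) + w.f (m + 1) := by
  rw [H.comm (m + 1), Homotopy.dNext_cochainComplex, Homotopy.prevD_succ_cochainComplex, hd,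
    zero_comp, zero_add]

theorem ContraExact.exists_homotopy_sq_zero {A C : 𝓒} {X : NSeq n A C}
    (hX : ContraExact n X.K) (u : X.K ⟶ X.K) (h0 : u.f 0 = 0) (hlast : u.f (n + 1) = 0) :
    Nonempty (Homotopy (u ≫ u) 0) := by
  obtain ⟨w, ⟨H⟩, hw⟩ := hX.exists_homotopy_vanishing u h0
  have hd : X.K.d (n + 1) (n + 2) = 0 := (X.isZero (n + 2) (by lia)).eq_of_tgt _ _
  have hwl : w.f (n + 1) = -H.hom (n + 1) n ≫ X.K.d n (n + 1) :=
    eq_neg_of_add_eq_zero_right ((f_succ_eq_of_homotopy H hd).symm.trans hlast)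
  have hww : w ≫ w = 0 := by
    ext i
    rcases lt_trichotomy i (n + 1) with hi | rfl | hi
    · simp [hw i (Nat.le_of_lt_succ hi)]
    · rw [HomologicalComplex.comp_f]
      nth_rw 1 [hwl]
      simp [← w.comm, hw n le_rfl]
    · exact (X.isZero i hi).eq_of_src _ _
  exact ⟨(H.comp H).trans (Homotopy.ofEq hww)⟩

theorem NSeq.Lifts.f_zero {A C : 𝓒} {X : NSeq n A C} {u : X.K ⟶ X.K}
    (h : NSeq.Lifts (X := X) (Y := X) u (𝟙 A) (𝟙 C)) : u.f 0 = 𝟙 _ := by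
  simpa [← cancel_mono X.α.hom] using h.left

theorem NSeq.Lifts.f_last {A C : 𝓒} {X : NSeq n A C} {u : X.K ⟶ X.K}
    (h : NSeq.Lifts (X := X) (Y := X) u (𝟙 A) (𝟙 C)) : u.f (n + 1) = 𝟙 _ := by
  simpa [← cancel_mono X.γ.hom] using h.right

-- `u = 𝟙 + v` with `v ≫ v` null-homotopic, so `𝟙 - v` is an inverse of `u` up to homotopy.
theorem NSeq.Lifts.exists_homotopy_comp_id {A C : 𝓒} {X : NSeq n A C} (hX : ContraExact n X.K)
    {u : X.K ⟶ X.K} (h : NSeq.Lifts (X := X) (Y := X) u (𝟙 A) (𝟙 C)) :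
    Nonempty (Homotopy (u ≫ (𝟙 _ + 𝟙 _ - u)) (𝟙 X.K)) := by
  obtain ⟨H⟩ := hX.exists_homotopy_sq_zero (u - 𝟙 _) (by simp [h.f_zero]) (by simp [h.f_last])
  refine ⟨(Homotopy.equivSubZero.symm ((Homotopy.ofEq ?_).trans H)).symm⟩
  simp only [Preadditive.comp_sub, Preadditive.sub_comp, Preadditive.comp_add, Category.comp_id,
    Category.id_comp]
  abel

theorem NSeq.htpyEquiv_of_lifts {A C : 𝓒} {X Y : NSeq n A C} (hX : ContraExact n X.K)
    (hY : ContraExact n Y.K) {f : X.K ⟶ Y.K} {g : Y.K ⟶ X.K}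
    (hf : NSeq.Lifts (X := X) (Y := Y) f (𝟙 A) (𝟙 C))
    (hg : NSeq.Lifts (X := Y) (Y := X) g (𝟙 A) (𝟙 C)) : NSeq.HtpyEquiv X Y := by
  have hfg := hf.comp hg
  obtain ⟨H₁⟩ := hfg.exists_homotopy_comp_id hX
  obtain ⟨H₂⟩ := (hg.comp hf).exists_homotopy_comp_id hY
  have hc : NSeq.Lifts (X := X) (Y := X) (𝟙 _ + 𝟙 _ - f ≫ g) (𝟙 A) (𝟙 C) :=
    ⟨by simp [hfg.f_zero, -HomologicalComplex.comp_f],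
      by simp [hfg.f_last, -HomologicalComplex.comp_f]⟩
  refine ⟨⟨f, g ≫ (𝟙 _ + 𝟙 _ - f ≫ g), (Homotopy.ofEq ?_).trans H₁,
    (Homotopy.ofEq ?_).trans H₂⟩, hf, hg.comp hc⟩
  · rw [Category.assoc]
  · simp only [Category.assoc, Preadditive.comp_sub, Preadditive.sub_comp, Preadditive.comp_add,
      Preadditive.add_comp, Category.comp_id]

end Homotopy

section DirectSum

variable {𝓒 : Type u} [Category.{v} 𝓒] [Preadditive 𝓒] [HasBinaryBiproducts 𝓒] {n : ℕ}

theorem biprod_lift_fst_snd (A B : 𝓒) :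
    biprod.lift (biprod.fst : A ⊞ B ⟶ A) biprod.snd = 𝟙 _ := by
  ext <;> simp

theorem biprod_desc_inl_inr (A B : 𝓒) :
    biprod.desc (biprod.inl : A ⟶ A ⊞ B) biprod.inr = 𝟙 _ := by
  ext <;> simp

theorem ContraExact.biprod {K L : CochainComplex 𝓒 ℕ} (hK : ContraExact n K)
    (hL : ContraExact n L) : ContraExact n (K ⊞ L) := by
  intro W i hi g hg
  obtain ⟨k, hk⟩ := hK W i hi ((biprod.inl : K ⟶ K ⊞ L).f (i + 1) ≫ g)
    (by rw [← HomologicalComplex.Hom.comm_assoc, hg, comp_zero])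
  obtain ⟨l, hl⟩ := hL W i hi ((biprod.inr : L ⟶ K ⊞ L).f (i + 1) ≫ g)
    (by rw [← HomologicalComplex.Hom.comm_assoc, hg, comp_zero])
  refine ⟨(biprod.fst : K ⊞ L ⟶ K).f (i + 2) ≫ k + (biprod.snd : K ⊞ L ⟶ L).f (i + 2) ≫ l, ?_⟩
  rw [Preadditive.comp_add, ← HomologicalComplex.Hom.comm_assoc,
    ← HomologicalComplex.Hom.comm_assoc, hk, hl, ← Category.assoc, ← Category.assoc,
    ← Preadditive.add_comp, HomologicalComplex.biprod_total_f, Category.id_comp]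

section

variable {ι : Type*} {c : ComplexShape ι} (K L : HomologicalComplex 𝓒 c) (i : ι)

theorem inl_f_comp_biprodXIso_hom :
    (biprod.inl : K ⟶ K ⊞ L).f i ≫ (HomologicalComplex.biprodXIso K L i).hom = biprod.inl := by
  rw [← HomologicalComplex.inl_biprodXIso_inv, Category.assoc, Iso.inv_hom_id, Category.comp_id]

theorem inr_f_comp_biprodXIso_hom :
    (biprod.inr : L ⟶ K ⊞ L).f i ≫ (HomologicalComplex.biprodXIso K L i).hom = biprod.inr := by
  rw [← HomologicalComplex.inr_biprodXIso_inv, Category.assoc, Iso.inv_hom_id, Category.comp_id]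

end

variable {A C A₁ C₁ A₂ C₂ : 𝓒} {X : NSeq n A₁ C₁} {Y : NSeq n A₂ C₂} {Z : NSeq n A C}

theorem NSeq.Lifts.biprod_lift {f : Z.K ⟶ X.K} {g : Z.K ⟶ Y.K} {a₁ : A ⟶ A₁} {c₁ : C ⟶ C₁}
    {a₂ : A ⟶ A₂} {c₂ : C ⟶ C₂} (hf : NSeq.Lifts (X := Z) (Y := X) f a₁ c₁)
    (hg : NSeq.Lifts (X := Z) (Y := Y) g a₂ c₂) :
    NSeq.Lifts (X := Z) (Y := X.sum Y) (biprod.lift f g) (biprod.lift a₁ a₂)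
      (biprod.lift c₁ c₂) := by
  constructor <;> apply biprod.hom_ext
  · simp [NSeq.sum, hf.left]
  · simp [NSeq.sum, hg.left]
  · simp [NSeq.sum, hf.right]
  · simp [NSeq.sum, hg.right]

theorem NSeq.Lifts.biprod_desc {f : X.K ⟶ Z.K} {g : Y.K ⟶ Z.K} {a₁ : A₁ ⟶ A} {c₁ : C₁ ⟶ C}
    {a₂ : A₂ ⟶ A} {c₂ : C₂ ⟶ C} (hf : NSeq.Lifts (X := X) (Y := Z) f a₁ c₁)
    (hg : NSeq.Lifts (X := Y) (Y := Z) g a₂ c₂) :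
    NSeq.Lifts (X := X.sum Y) (Y := Z) (biprod.desc f g) (biprod.desc a₁ a₂)
      (biprod.desc c₁ c₂) := by
  constructor <;> apply HomologicalComplex.biprodX_ext_from
  · simp [NSeq.sum, hf.left, reassoc_of% inl_f_comp_biprodXIso_hom]
  · simp [NSeq.sum, hg.left, reassoc_of% inr_f_comp_biprodXIso_hom]
  · simp [NSeq.sum, hf.right, reassoc_of% inl_f_comp_biprodXIso_hom]
  · simp [NSeq.sum, hg.right, reassoc_of% inr_f_comp_biprodXIso_hom]

theorem IsNExangulated.realize_sum {E : 𝓒ᵒᵖ ⥤ 𝓒 ⥤ AddCommGrpCat.{w}} {s : Corr n E}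
    (h : IsNExangulated n E s) {δ : Ext E C₁ A₁} {ρ : Ext E C₂ A₂} (hX : s δ = ⟦X⟧)
    (hY : s ρ = ⟦Y⟧) : s (extSum E δ ρ) = ⟦X.sum Y⟧ := by
  have := h.additive_left
  have := h.additive_right
  obtain ⟨Z, hZ⟩ := exists_realization s (extSum E δ ρ)
  obtain ⟨f₁, hf₁⟩ := h.exists_lift δ (extSum E δ ρ) X Z hX hZ biprod.inl biprod.inl
    (by simp [extSum, ← pull_comp, zero_pull])
  obtain ⟨f₂, hf₂⟩ := h.exists_lift ρ (extSum E δ ρ) Y Z hY hZ biprod.inr biprod.inr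
    (by simp [extSum, ← pull_comp, zero_pull])
  obtain ⟨g₁, hg₁⟩ := h.exists_lift (extSum E δ ρ) δ Z X hZ hX biprod.fst biprod.fst
    (by simp [extSum, ← push_comp, zero_push, push_pull])
  obtain ⟨g₂, hg₂⟩ := h.exists_lift (extSum E δ ρ) ρ Z Y hZ hY biprod.snd biprod.snd
    (by simp [extSum, ← push_comp, zero_push, push_pull])
  rw [hZ]
  have hg := hg₁.biprod_lift hg₂
  have hf := hf₁.biprod_desc hf₂
  rw [biprod_lift_fst_snd, biprod_lift_fst_snd] at hg
  rw [biprod_desc_inl_inr, biprod_desc_inl_inr] at hf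
  exact Quotient.sound (NSeq.htpyEquiv_of_lifts (h.exangle _ Z hZ).contra
    ((h.exangle _ X hX).contra.biprod (h.exangle _ Y hY).contra) hg hf)

end DirectSum

section Restriction

variable {𝓒 : Type u} [Category.{v} 𝓒] [Preadditive 𝓒] {n : ℕ}

/-- The morphisms that are the last differential of a sequence of the class `𝒳`. -/
def deflations (𝒳 : SeqClass 𝓒 n) : MorphismProperty 𝓒 := fun _ _ g => IsDeflation 𝒳 g

theorem NSeq.isInflation_inf {𝒳 : SeqClass 𝓒 n} {A C : 𝓒} (X : NSeq n A C) (hX : 𝒳 X) :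
    IsInflation 𝒳 X.inf :=
  ⟨C, X, Iso.refl _, hX, Category.comp_id _⟩

theorem NSeq.isDeflation_defl {𝒳 : SeqClass 𝓒 n} {A C : 𝓒} (X : NSeq n A C) (hX : 𝒳 X) :
    IsDeflation 𝒳 X.defl :=
  ⟨A, X, Iso.refl _, hX, Category.id_comp _⟩

variable {E : 𝓒ᵒᵖ ⥤ 𝓒 ⥤ AddCommGrpCat.{w}} {s : Corr n E}

namespace AddSubBifunctor

variable (F : AddSubBifunctor E)

theorem conf_restrict_iff {A C : 𝓒} (X : NSeq n A C) :
    Conf (F.restrict s) X ↔ ∃ δ ∈ F.grp C A, s δ = ⟦X⟧ :=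
  ⟨fun ⟨δ, hδ⟩ => ⟨δ.1, δ.2, hδ⟩, fun ⟨δ, hδ, h⟩ => ⟨⟨δ, hδ⟩, h⟩⟩

theorem conf_of_restrict {A C : 𝓒} {X : NSeq n A C} (h : Conf (F.restrict s) X) : Conf s X :=
  let ⟨δ, hδ⟩ := h
  ⟨δ.1, hδ⟩

theorem isInflation_of_restrict {A B : 𝓒} {f : A ⟶ B}
    (h : IsInflation (Conf (F.restrict s)) f) : IsInflation (Conf s) f :=
  let ⟨C, X, e, hX, he⟩ := h
  ⟨C, X, e, F.conf_of_restrict hX, he⟩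

theorem isDeflation_of_restrict {B C : 𝓒} {g : B ⟶ C}
    (h : IsDeflation (Conf (F.restrict s)) g) : IsDeflation (Conf s) g :=
  let ⟨A, X, e, hX, he⟩ := h
  ⟨A, X, e, F.conf_of_restrict hX, he⟩

theorem extSum_mem [HasBinaryBiproducts 𝓒] {A C A' C' : 𝓒} {δ : Ext E C A} {ρ : Ext E C' A'}
    (hδ : δ ∈ F.grp C A) (hρ : ρ ∈ F.grp C' A') : extSum E δ ρ ∈ F.grp (C ⊞ C') (A ⊞ A') :=
  (F.grp _ _).add_mem (F.pull_mem _ _ (F.push_mem _ _ hδ)) (F.pull_mem _ _ (F.push_mem _ _ hρ))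

end AddSubBifunctor

namespace IsNExangulated

variable [HasBinaryBiproducts 𝓒] {F : AddSubBifunctor E} (h : IsNExangulated n E s) (hn : 1 ≤ n)

include h hn

theorem mem_of_pull_eq_zero {A B C : 𝓒} {g : B ⟶ C} (hg : IsDeflation (Conf (F.restrict s)) g)
    {τ : Ext E C A} (hτ : pull E g τ = 0) : τ ∈ F.grp C A := by
  obtain ⟨A', X, e, ⟨δ, hX⟩, rfl⟩ := hg
  have hdefl : pull E X.defl τ = 0 := by
    rw [← Iso.hom_inv_id_assoc e X.defl, pull_comp, hτ, pull_zero]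
  obtain ⟨a, rfl⟩ := h.exists_push_eq hn (δ := δ.1) hX hdefl
  exact F.push_mem a _ δ.2

theorem mem_of_push_eq_zero {A B W : 𝓒} {f : A ⟶ B} (hf : IsInflation (Conf (F.restrict s)) f)
    {τ : Ext E W A} (hτ : push E f τ = 0) : τ ∈ F.grp W A := by
  obtain ⟨C, X, e, ⟨δ, hX⟩, rfl⟩ := hf
  have hinf : push E X.inf τ = 0 := by
    rw [← Category.comp_id X.inf, ← e.hom_inv_id, ← Category.assoc, push_comp, hτ, push_zero]
  obtain ⟨c, rfl⟩ := h.exists_pull_eq hn (δ := δ.1) hX hinf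
  exact F.pull_mem c _ δ.2

variable [(deflations (Conf (F.restrict s))).IsStableUnderComposition]

theorem mem_of_pull_mem {A B C : 𝓒} {g : B ⟶ C} (hg : IsDeflation (Conf (F.restrict s)) g)
    {τ : Ext E C A} (hτ : pull E g τ ∈ F.grp B A) : τ ∈ F.grp C A := by
  obtain ⟨P, hP⟩ := exists_realization s (pull E g τ)
  have hdefl : IsDeflation (Conf (F.restrict s)) P.defl :=
    P.isDeflation_defl ((F.conf_restrict_iff P).2 ⟨_, hτ, hP⟩)
  refine h.mem_of_pull_eq_zero hn
    ((deflations (Conf (F.restrict s))).comp_mem P.defl g hdefl hg) ?_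
  rw [pull_comp, (h.exangle _ P hP).pull_defl]

theorem isInflation_comp_restrict {A B C : 𝓒} (f : A ⟶ B) (g : B ⟶ C)
    (hf : IsInflation (Conf (F.restrict s)) f) (hg : IsInflation (Conf (F.restrict s)) g) :
    IsInflation (Conf (F.restrict s)) (f ≫ g) := by
  obtain ⟨D, T, e, ⟨τ, hT⟩, he⟩ := h.inflation_comp f g (F.isInflation_of_restrict hf)
    (F.isInflation_of_restrict hg)
  have hfτ : push E f τ ∈ F.grp D B := by
    refine h.mem_of_push_eq_zero hn hg ?_
    rw [← push_comp, ← he, push_comp, (h.exangle τ T hT).push_inf, push_zero]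
  obtain ⟨Z, hZ⟩ := exists_realization s (push E f τ)
  have hZτ : pull E Z.defl τ ∈ F.grp _ A := by
    refine h.mem_of_push_eq_zero hn hf ?_
    rw [push_pull, (h.exangle _ Z hZ).pull_defl]
  have hτ : τ ∈ F.grp D A :=
    h.mem_of_pull_mem hn
      (Z.isDeflation_defl ((F.conf_restrict_iff Z).2 ⟨_, hfτ, hZ⟩)) hZτ
  exact ⟨D, T, e, (F.conf_restrict_iff T).2 ⟨τ, hτ, hT⟩, he⟩

theorem restrict : IsNExangulated n F.toBifunctor (F.restrict s) where
  additive_left := by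
    have := h.additive_left
    refine ⟨fun {C C' f g} => ?_⟩
    ext A δ
    exact Subtype.ext (add_pull (E := E) f.unop g.unop δ.1)
  additive_right C := by
    have := h.additive_right
    refine ⟨fun {A A' f g} => ?_⟩
    ext δ
    exact Subtype.ext (add_push (E := E) f g δ.1)
  exists_lift δ ρ X Y hX hY a c hac :=
    h.exists_lift δ.1 ρ.1 X Y hX hY a c (congrArg Subtype.val hac)
  exangle δ X hX :=
    have hE := h.exangle δ.1 X hX
    { cov := hE.cov
      cov_last := fun W g => Subtype.ext_iff.trans (hE.cov_last W g)
      contra := hE.contra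
      contra_last := fun W g => Subtype.ext_iff.trans (hE.contra_last W g) }
  split_left hZ X h₁ h₂ := h.split_left hZ X h₁ h₂
  split_right hZ X h₁ h₂ := h.split_right hZ X h₁ h₂
  inflation_comp := h.isInflation_comp_restrict hn
  deflation_comp := (deflations (Conf (F.restrict s))).comp_mem
  good_lift ρ c X Y hX hY := h.good_lift ρ.1 c X Y hX hY
  good_lift_op ρ a X Y hX hY := h.good_lift_op ρ.1 a X Y hX hY

end IsNExangulated

end Restriction

section Proper

variable {𝓒 : Type u} [Category.{v} 𝓒] [Preadditive 𝓒] [HasBinaryBiproducts 𝓒] {n : ℕ}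
  {E : 𝓒ᵒᵖ ⥤ 𝓒 ⥤ AddCommGrpCat.{w}} {s : Corr n E} {ξ : ExangleClass n E}

namespace IsNProper

variable (hξ : IsNProper s ξ)

include hξ

theorem exists_push {A A' C : 𝓒} (a : A ⟶ A') (δ : Ext E C A) :
    (∃ X : NSeq n A C, ξ X δ) → ∃ X : NSeq n A' C, ξ X (push E a δ) := fun ⟨X, hX⟩ =>
  let ⟨Y, hY⟩ := exists_realization s (push E a δ)
  ⟨Y, hξ.cobase_change X δ a Y hX hY⟩

theorem exists_pull {A C C' : 𝓒} (c : C' ⟶ C) (δ : Ext E C A) :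
    (∃ X : NSeq n A C, ξ X δ) → ∃ X : NSeq n A C', ξ X (pull E c δ) := fun ⟨X, hX⟩ =>
  let ⟨Y, hY⟩ := exists_realization s (pull E c δ)
  ⟨Y, hξ.base_change X δ c Y hX hY⟩

/-- The additive subfunctor `𝔼_ξ` of an `n`-proper class `ξ`: the extensions that are realized by
a member of `ξ`. -/
def subfunctor [∀ C : 𝓒, (E.obj (op C)).Additive] : AddSubBifunctor E where
  grp C A :=
    { carrier := {δ | ∃ X : NSeq n A C, ξ X δ}
      zero_mem' :=
        let ⟨X, hX⟩ := exists_realization s (0 : Ext E C A)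
        ⟨X, hξ.split_mem X hX⟩
      add_mem' := by
        rintro δ δ' ⟨X, hX⟩ ⟨Y, hY⟩
        rw [← pull_lift_push_desc_extSum]
        exact hξ.exists_pull _ _ (hξ.exists_push _ _ ⟨_, hξ.sum_mem X δ Y δ' hX hY⟩)
      neg_mem' := by
        intro δ hδ
        rw [← push_id δ, ← neg_push]
        exact hξ.exists_push _ δ hδ }
  push_mem := hξ.exists_push
  pull_mem := hξ.exists_pull

end IsNProper

theorem ClosedUnderWeakIso.mem_of_realize (h : IsNExangulated n E s)
    (hw : ClosedUnderWeakIso s ξ) {A C : 𝓒} {X Y : NSeq n A C} {δ : Ext E C A}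
    (hX : s δ = ⟦X⟧) (hY : s δ = ⟦Y⟧) (hξ : ξ X δ) : ξ Y δ := by
  obtain ⟨f, hf⟩ := h.exists_lift δ δ X Y hX hY (𝟙 A) (𝟙 C) (by simp)
  exact (hw X δ Y δ hX hY f _ _ hf (by simp) inferInstance inferInstance).1 hξ

namespace IsSubfunctorOf

variable {F : AddSubBifunctor E} (hF : IsSubfunctorOf ξ F) (h : IsNExangulated n E s)
  (hd : ∀ ⦃A C : 𝓒⦄ (X : NSeq n A C) (δ : Ext E C A), ξ X δ → s δ = ⟦X⟧)
  (hw : ClosedUnderWeakIso s ξ)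

include hF h hd hw

theorem mem_class_iff {A C : 𝓒} (X : NSeq n A C) (δ : Ext E C A) :
    ξ X δ ↔ δ ∈ F.grp C A ∧ s δ = ⟦X⟧ := by
  refine ⟨fun hX => ⟨(hF _ _ _).2 ⟨X, hX⟩, hd X δ hX⟩, fun ⟨hδ, hX⟩ => ?_⟩
  obtain ⟨Y, hY⟩ := (hF _ _ _).1 hδ
  exact hw.mem_of_realize h (hd Y δ hY) hX hY

theorem seqs_eq_conf_restrict : ξ.seqs = Conf (F.restrict s) := by
  ext A C X
  simp only [ExangleClass.seqs, hF.mem_class_iff h hd hw, F.conf_restrict_iff]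

theorem isNProper (hn : 1 ≤ n) (hFn : IsNExangulated n F.toBifunctor (F.restrict s)) :
    IsNProper s ξ := by
  have mem_iff : ∀ {A C : 𝓒} (X : NSeq n A C) (δ : Ext E C A),
      ξ X δ ↔ δ ∈ F.grp C A ∧ s δ = ⟦X⟧ := hF.mem_class_iff h hd hw
  refine ⟨fun X => hd X, fun X hX => ?_, hw, fun X δ Y ρ hX hY => ?_, fun X δ c Y hX hY => ?_,
    fun X δ a Y hX hY => ?_, fun a b c d hac _ _ hd' ha hb => ?_⟩
  · exact (mem_iff _ _).2 ⟨(F.grp _ _).zero_mem, hX⟩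
  · exact (mem_iff _ _).2 ⟨F.extSum_mem ((mem_iff _ _).1 hX).1 ((mem_iff _ _).1 hY).1,
      h.realize_sum (hd X δ hX) (hd Y ρ hY)⟩
  · exact (mem_iff _ _).2 ⟨F.pull_mem _ _ ((mem_iff _ _).1 hX).1, hY⟩
  · exact (mem_iff _ _).2 ⟨F.push_mem _ _ ((mem_iff _ _).1 hX).1, hY⟩
  · rw [hF.seqs_eq_conf_restrict h hd hw] at ha hb ⊢
    obtain ⟨K, X, e, ⟨δ, hX⟩, rfl⟩ := hd'
    have hδ : pull E (a ≫ b) δ = 0 := by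
      rw [hac, pull_comp, pull_comp, (h.exangle δ X hX).pull_defl, pull_zero, pull_zero]
    exact ⟨K, X, e, (F.conf_restrict_iff X).2
      ⟨δ, h.mem_of_pull_eq_zero hn (hFn.deflation_comp a b ha hb) hδ, hX⟩, rfl⟩

end IsSubfunctorOf

theorem IsNProper.restrictionIsNExangulated (hξ : IsNProper s ξ) (h : IsNExangulated n E s)
    (hn : 1 ≤ n) : RestrictionIsNExangulated s ξ := by
  have := h.additive_right
  have hF : IsSubfunctorOf ξ hξ.subfunctor := fun _ _ _ => Iff.rfl
  refine ⟨hξ.subfunctor, hF, ?_⟩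
  have hcomp : (deflations (Conf (hξ.subfunctor.restrict s))).IsStableUnderComposition := by
    refine ⟨fun f g hf hg => ?_⟩
    have hf' := hξ.subfunctor.isDeflation_of_restrict hf
    have hg' := hξ.subfunctor.isDeflation_of_restrict hg
    have seqs_eq := hF.seqs_eq_conf_restrict h (fun _ _ => hξ.distinguished) hξ.weakIso
    rw [← seqs_eq] at hf hg ⊢
    exact hξ.saturated f g (𝟙 _) (f ≫ g) (by simp) hf' hg' (h.deflation_comp f g hf' hg') hf hg
  exact h.restrict hn

theorem isNProper_iff_restrictionIsNExangulated (h : IsNExangulated n E s) (hn : 1 ≤ n)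
    (hd : ∀ ⦃A C : 𝓒⦄ (X : NSeq n A C) (δ : Ext E C A), ξ X δ → s δ = ⟦X⟧)
    (hw : ClosedUnderWeakIso s ξ) : IsNProper s ξ ↔ RestrictionIsNExangulated s ξ :=
  ⟨fun hξ => hξ.restrictionIsNExangulated h hn,
    fun ⟨_, hF, hFn⟩ => hF.isNProper h hd hw hn hFn⟩

end Proper

section NExact

variable {𝓒 : Type u} [Category.{v} 𝓒] [Preadditive 𝓒] {n : ℕ}

theorem LeftNExact.mono_d {A C : 𝓒} {X : NSeq n A C} (hX : LeftNExact X) :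
    Mono (X.K.d 0 1) := by
  have := hX.mono
  have hd : X.K.d 0 1 = X.α.hom ≫ X.inf := by simp [NSeq.inf]
  rw [hd]
  infer_instance

theorem RightNExact.epi_d {A C : 𝓒} {X : NSeq n A C} (hX : RightNExact X) :
    Epi (X.K.d n (n + 1)) := by
  have := hX.epi
  have hd : X.K.d n (n + 1) = X.defl ≫ X.γ.inv := by simp [NSeq.defl]
  rw [hd]
  infer_instance

section WeakIso

variable {K L : CochainComplex 𝓒 ℕ} {f : K ⟶ L} {j k : ℕ}

/-- `f` has a retraction in degree `j` up to homotopy, after composition with the differential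
that leaves this degree. The morphism `g` is part of a commutative square, so that it can be
continued to lower degrees when `K` is exact. -/
def HasRetractionAt (f : K ⟶ L) (j : ℕ) : Prop :=
  ∃ (g : L.X j ⟶ K.X j) (g' : L.X (j + 1) ⟶ K.X (j + 1)) (t : K.X (j + 1) ⟶ K.X j),
    g ≫ K.d j (j + 1) = L.d j (j + 1) ≫ g' ∧
      (f.f j ≫ g + K.d j (j + 1) ≫ t) ≫ K.d j (j + 1) = K.d j (j + 1)

/-- `f` has a section in degree `j + 1` up to homotopy, after composition with the differential
that enters this degree. The morphism `g` is part of a commutative square, so that it can be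
continued to higher degrees when `L` is exact. -/
def HasSectionAt (f : K ⟶ L) (j : ℕ) : Prop :=
  ∃ (g : L.X (j + 1) ⟶ K.X (j + 1)) (g' : L.X j ⟶ K.X j) (t : L.X (j + 1) ⟶ L.X j),
    L.d j (j + 1) ≫ g = g' ≫ K.d j (j + 1) ∧
      L.d j (j + 1) ≫ (g ≫ f.f (j + 1) + t ≫ L.d j (j + 1)) = L.d j (j + 1)

theorem HasRetractionAt.of_isIso [IsIso (f.f j)] [IsIso (f.f (j + 1))] : HasRetractionAt f j :=
  ⟨inv (f.f j), inv (f.f (j + 1)), 0, by simp [IsIso.inv_comp_eq], by simp⟩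

theorem HasSectionAt.of_isIso [IsIso (f.f j)] [IsIso (f.f (j + 1))] : HasSectionAt f j :=
  ⟨inv (f.f (j + 1)), inv (f.f j), 0, by simp [IsIso.eq_inv_comp], by simp⟩

theorem HasRetractionAt.of_succ (hK : CovExact n K) (hj : j < n) (h : HasRetractionAt f (j + 1)) :
    HasRetractionAt f j := by
  obtain ⟨g, g', t, hg, ht⟩ := h
  obtain ⟨g₀, hg₀⟩ := hK _ j hj (L.d j (j + 1) ≫ g) (by simp [hg])
  obtain ⟨t₀, ht₀⟩ := hK _ j hj (𝟙 _ - (f.f (j + 1) ≫ g + K.d (j + 1) (j + 2) ≫ t))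
    (by rw [Preadditive.sub_comp, ht, Category.id_comp, sub_self])
  refine ⟨g₀, g, t₀, hg₀, ?_⟩
  rw [Preadditive.add_comp, Category.assoc, Category.assoc, hg₀, ht₀]
  simp

theorem HasSectionAt.succ (hL : ContraExact n L) (hj : j < n) (h : HasSectionAt f j) :
    HasSectionAt f (j + 1) := by
  obtain ⟨g, g', t, hg, ht⟩ := h
  obtain ⟨g₀, hg₀⟩ := hL _ j hj (g ≫ K.d (j + 1) (j + 2)) (by simp [reassoc_of% hg])
  obtain ⟨t₀, ht₀⟩ := hL _ j hj (𝟙 _ - (g ≫ f.f (j + 1) + t ≫ L.d j (j + 1)))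
    (by rw [Preadditive.comp_sub, ht, Category.comp_id, sub_self])
  refine ⟨g₀, g, t₀, hg₀, ?_⟩
  rw [Preadditive.comp_add, reassoc_of% hg₀, reassoc_of% ht₀]
  simp

theorem HasRetractionAt.zero (hK : CovExact n K) (hk : k ≤ n) (h : HasRetractionAt f k) :
    HasRetractionAt f 0 := by
  induction k with
  | zero => exact h
  | succ k ih => exact ih (Nat.le_of_succ_le hk) (h.of_succ hK hk)

theorem HasSectionAt.last (hL : ContraExact n L) (hk : k ≤ n) (h : HasSectionAt f k) :
    HasSectionAt f n :=
  Nat.decreasingInduction (motive := fun j _ => HasSectionAt f j → HasSectionAt f n)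
    (fun _ hj ih h => ih (h.succ hL hj)) id hk h

end WeakIso

namespace JassoWeakIso

variable {A C A' C' : 𝓒} {X : NSeq n A C} {Y : NSeq n A' C'} {f : X.K ⟶ Y.K} {a : A ⟶ A'}
  {c : C ⟶ C'} (hf : JassoWeakIso (X := X) (Y := Y) f)
  (hac : NSeq.Lifts (X := X) (Y := Y) f a c)

include hf hac

theorem exists_retraction (hX : LeftNExact X) :
    ∃ (b : A' ⟶ A) (t : X.K.X 1 ⟶ A), a ≫ b + X.inf ≫ t = 𝟙 A := by
  obtain ⟨g, t, hgt⟩ : ∃ (g : Y.K.X 0 ⟶ X.K.X 0) (t : X.K.X 1 ⟶ X.K.X 0),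
      f.f 0 ≫ g + X.K.d 0 1 ≫ t = 𝟙 _ := by
    rcases hf with ⟨k, hk, _, _⟩ | ⟨_, _⟩
    · obtain ⟨g, -, t, -, ht⟩ := (HasRetractionAt.of_isIso (f := f) (j := k)).zero hX.exact hk
      have := hX.mono_d
      exact ⟨g, t, by rwa [← cancel_mono (X.K.d 0 1), Category.id_comp]⟩
    · exact ⟨inv (f.f 0), 0, by simp⟩
  have ha : a = X.α.inv ≫ f.f 0 ≫ Y.α.hom := by rw [hac.left, Iso.inv_hom_id_assoc]
  refine ⟨Y.α.inv ≫ g ≫ X.α.hom, t ≫ X.α.hom, ?_⟩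
  calc
    _ = X.α.inv ≫ (f.f 0 ≫ g + X.K.d 0 1 ≫ t) ≫ X.α.hom := by simp [ha, NSeq.inf]
    _ = 𝟙 A := by simp [hgt]

theorem exists_section (hY : RightNExact Y) :
    ∃ (b : C' ⟶ C) (t : C' ⟶ Y.K.X n), b ≫ c + t ≫ Y.defl = 𝟙 C' := by
  obtain ⟨g, t, hgt⟩ : ∃ (g : Y.K.X (n + 1) ⟶ X.K.X (n + 1)) (t : Y.K.X (n + 1) ⟶ Y.K.X n),
      g ≫ f.f (n + 1) + t ≫ Y.K.d n (n + 1) = 𝟙 _ := by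
    rcases hf with ⟨k, hk, _, _⟩ | ⟨_, _⟩
    · obtain ⟨g, -, t, -, ht⟩ := (HasSectionAt.of_isIso (f := f) (j := k)).last hY.exact hk
      have := hY.epi_d
      exact ⟨g, t, by rwa [← cancel_epi (Y.K.d n (n + 1)), Category.comp_id]⟩
    · exact ⟨inv (f.f (n + 1)), 0, by simp⟩
  have hc : c = X.γ.inv ≫ f.f (n + 1) ≫ Y.γ.hom := by rw [hac.right, Iso.inv_hom_id_assoc]
  refine ⟨Y.γ.inv ≫ g ≫ X.γ.hom, Y.γ.inv ≫ t, ?_⟩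
  calc
    _ = Y.γ.inv ≫ (g ≫ f.f (n + 1) + t ≫ Y.K.d n (n + 1)) ≫ Y.γ.hom := by
      simp [hc, NSeq.defl]
    _ = 𝟙 C' := by simp [hgt]

end JassoWeakIso

/-- A morphism that vanishes in degree `0` is homotopic to one that vanishes in the degrees
`0, …, n`, which must vanish in degree `n + 1` too because the last differential is an
epimorphism. -/
theorem RightNExact.exists_eq_comp_d {A C : 𝓒} {X : NSeq n A C} (hX : RightNExact X)
    {L : CochainComplex 𝓒 ℕ} (u : X.K ⟶ L) (h0 : u.f 0 = 0) :
    ∃ t : X.K.X (n + 1) ⟶ L.X n, u.f (n + 1) = t ≫ L.d n (n + 1) := by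
  obtain ⟨w, ⟨H⟩, hw⟩ := hX.exact.exists_homotopy_vanishing u h0
  have hlast : w.f (n + 1) = 0 := by
    have := hX.epi_d
    rw [← cancel_epi (X.K.d n (n + 1)), ← w.comm, hw n le_rfl, zero_comp, comp_zero]
  have hd : X.K.d (n + 1) (n + 2) = 0 := (X.isZero _ (Nat.lt_succ_self _)).eq_of_tgt _ _
  exact ⟨H.hom (n + 1) n, by rw [f_succ_eq_of_homotopy H hd, hlast, add_zero]⟩

variable [HasBinaryBiproducts 𝓒] {E : 𝓒ᵒᵖ ⥤ 𝓒 ⥤ AddCommGrpCat.{w}} {s : Corr n E}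

namespace IsNExangulated

variable (h : IsNExangulated n E s)

include h

section WeakIso

variable (hn : 1 ≤ n) {A C A' C' : 𝓒} {X : NSeq n A C} {Y : NSeq n A' C'} {δ : Ext E C A}
  {ρ : Ext E C' A'} (hX : s δ = ⟦X⟧) (hY : s ρ = ⟦Y⟧) (hXr : RightNExact X)
  {f : X.K ⟶ Y.K}

include hn hX hY hXr

theorem push_eq_pull_of_lifts {a : A ⟶ A'} {c : C ⟶ C'}
    (hf : NSeq.Lifts (X := X) (Y := Y) f a c) : push E a δ = pull E c ρ := by
  have := h.additive_left
  have hinf : a ≫ Y.inf = X.inf ≫ f.f 1 := by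
    rw [NSeq.inf, NSeq.inf, Category.assoc, ← f.comm, Iso.eq_inv_comp, ← reassoc_of% hf.left,
      Iso.hom_inv_id_assoc]
  obtain ⟨c', hc'⟩ := h.exists_pull_eq hn hY (τ := push E a δ) (by
    rw [← push_comp, hinf, push_comp, (h.exangle δ X hX).push_inf, push_zero])
  obtain ⟨g, hg⟩ := h.exists_lift δ ρ X Y hX hY a c' hc'.symm
  obtain ⟨t, ht⟩ := hXr.exists_eq_comp_d (f - g) (by
    rw [← cancel_mono Y.α.hom]
    simp [hf.left, hg.left])
  have hc : c = c' + (X.γ.inv ≫ t) ≫ Y.defl := by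
    rw [← sub_eq_iff_eq_add', ← cancel_epi X.γ.hom, Preadditive.comp_sub, ← hf.right, ← hg.right,
      ← Preadditive.sub_comp, ← HomologicalComplex.sub_f_apply, ht]
    simp [NSeq.defl]
  rw [hc, add_pull, pull_comp _ Y.defl, (h.exangle ρ Y hY).pull_defl, pull_zero, add_zero, hc']

theorem mem_iff_mem_of_jassoWeakIso {F : AddSubBifunctor E} (hXl : LeftNExact X)
    (hYr : RightNExact Y) (hf : JassoWeakIso (X := X) (Y := Y) f) :
    δ ∈ F.grp C A ↔ ρ ∈ F.grp C' A' := by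
  have := h.additive_left
  have := h.additive_right
  let a : A ⟶ A' := X.α.inv ≫ f.f 0 ≫ Y.α.hom
  let c : C ⟶ C' := X.γ.inv ≫ f.f (n + 1) ≫ Y.γ.hom
  have hac : NSeq.Lifts (X := X) (Y := Y) f a c := ⟨by simp [a], by simp [c]⟩
  have push_eq_pull : push E a δ = pull E c ρ := h.push_eq_pull_of_lifts hn hX hY hXr hac
  constructor
  · intro hδ
    obtain ⟨b, t, hb⟩ := hf.exists_section hac hYr
    rw [← (h.exangle ρ Y hY).pull_pull_eq_self hb, ← push_eq_pull]
    exact F.pull_mem _ _ (F.push_mem _ _ hδ)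
  · intro hρ
    obtain ⟨b, t, hb⟩ := hf.exists_retraction hac hXl
    rw [← (h.exangle δ X hX).push_push_eq_self hb, push_eq_pull]
    exact F.push_mem _ _ (F.pull_mem _ _ hρ)

end WeakIso

theorem isNExactStructure
    (hexact : ∀ {A C : 𝓒} (X : NSeq n A C), Conf s X → IsNExactSeq X)
    (hweak : ∀ {A C A' C' : 𝓒} (X : NSeq n A C) (Y : NSeq n A' C'), IsNExactSeq X →
      IsNExactSeq Y → ∀ f : X.K ⟶ Y.K, JassoWeakIso (X := X) (Y := Y) f → (Conf s X ↔ Conf s Y)) :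
    IsNExactStructure (Conf s) where
  nExact := hexact
  weakIso := hweak
  zero {A C} X hX :=
    have hA : IsZero A := (hX 0).of_iso X.α.symm
    have hC : IsZero C := (hX (n + 1)).of_iso X.γ.symm
    ⟨0, h.split_left hC X (isIso_of_isInitial hA.isInitial (hX 1).isInitial X.inf)
      fun i _ => hX i⟩
  mono_comp := h.inflation_comp
  epi_comp := h.deflation_comp
  pushout := by
    rintro A C X ⟨δ, hX⟩ B a
    obtain ⟨Y, hY⟩ := exists_realization s (push E a δ)
    obtain ⟨φ, hφ, N, hN⟩ := h.good_lift_op δ a X Y hX hY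
    exact ⟨Y.K, φ, Y.α, N, hφ.left, (hexact N.seq ⟨_, hN⟩).2, Y.isInflation_inf ⟨_, hY⟩⟩
  pullback := by
    rintro A C X ⟨δ, hX⟩ B c
    obtain ⟨Y, hY⟩ := exists_realization s (pull E c δ)
    obtain ⟨φ, hφ, M, hM⟩ := h.good_lift δ c Y X hY hX
    exact ⟨Y.K, φ, Y.γ, M, hφ.right, (hexact M.seq ⟨_, hM⟩).1, Y.isDeflation_defl ⟨_, hY⟩⟩

end IsNExangulated

namespace IsNExact

variable (h : IsNExact n E s) (hn : 1 ≤ n)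

include h hn

theorem restrict {F : AddSubBifunctor E} (hF : IsNExangulated n F.toBifunctor (F.restrict s)) :
    IsNExact n F.toBifunctor (F.restrict s) where
  exangulated := hF
  injective A C δ ρ hδρ := Subtype.ext (h.injective A C hδρ)
  nExact := by
    refine hF.isNExactStructure (fun X hX => h.nExact.nExact X (F.conf_of_restrict hX))
      fun X Y hXe hYe f hf => ?_
    have conf_iff : Conf s X ↔ Conf s Y := h.nExact.weakIso X Y hXe hYe f hf
    have mem_iff : ∀ {δ ρ}, s δ = ⟦X⟧ → s ρ = ⟦Y⟧ → (δ ∈ F.grp _ _ ↔ ρ ∈ F.grp _ _) :=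
      fun hX hY => h.exangulated.mem_iff_mem_of_jassoWeakIso hn hX hY hXe.2 hXe.1 hYe.2 hf
    rw [F.conf_restrict_iff, F.conf_restrict_iff]
    constructor
    · rintro ⟨δ, hδ, hX⟩
      obtain ⟨ρ, hY⟩ := conf_iff.1 ⟨δ, hX⟩
      exact ⟨ρ, (mem_iff hX hY).1 hδ, hY⟩
    · rintro ⟨ρ, hρ, hY⟩
      obtain ⟨δ, hX⟩ := conf_iff.2 ⟨ρ, hY⟩
      exact ⟨δ, (mem_iff hX hY).2 hρ, hX⟩

theorem restrictionIsNExact_iff {ξ : ExangleClass n E} :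
    RestrictionIsNExact s ξ ↔ RestrictionIsNExangulated s ξ :=
  ⟨fun ⟨F, hF, hFn⟩ => ⟨F, hF, hFn.exangulated⟩, fun ⟨F, hF, hFn⟩ => ⟨F, hF, h.restrict hn hFn⟩⟩

end IsNExact

end NExact

end NExang

open NExang in
theorem corollary4p6_general {𝓒 : Type u} [Category.{v} 𝓒] [Preadditive 𝓒]
    [HasBinaryBiproducts 𝓒] {n : ℕ} (hn : 1 ≤ n) {E : 𝓒ᵒᵖ ⥤ 𝓒 ⥤ AddCommGrpCat.{w}}
    {s : Corr n E} (h : IsNExangulated n E s) {ξ : ExangleClass n E}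
    (hd : ∀ ⦃A C : 𝓒⦄ (X : NSeq n A C) (δ : Ext E C A), ξ X δ → s δ = ⟦X⟧)
    (hw : ClosedUnderWeakIso s ξ) :
    (IsNExact n E s → (IsNProper s ξ ↔ RestrictionIsNExact s ξ)) ∧
      (IsNProper s ξ ↔ RestrictionIsNExangulated s ξ) :=
  have proper_iff := isNProper_iff_restrictionIsNExangulated h hn hd hw
  ⟨fun hE => proper_iff.trans (hE.restrictionIsNExact_iff hn).symm, proper_iff⟩

theorem corollary4p6 {𝓒 : Type u} [CategoryTheory.Category.{v} 𝓒]
    [CategoryTheory.Preadditive 𝓒] [CategoryTheory.Limits.HasZeroObject 𝓒]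
    [CategoryTheory.Limits.HasBinaryBiproducts 𝓒]
    (n : ℕ) (hn : 1 ≤ n) (E : 𝓒ᵒᵖ ⥤ 𝓒 ⥤ AddCommGrpCat.{w}) (s : NExang.Corr n E)
    (h : NExang.IsNExangulated n E s) :
    (NExang.IsNExact n E s →
      ∀ ξ : NExang.SeqClass 𝓒 n,
        (∀ ⦃A C : 𝓒⦄ (X : NExang.NSeq n A C), ξ X → NExang.Conf s X) →
        NExang.ClosedUnderWeakIso s (NExang.inducedClass s ξ) →
        (NExang.IsNProper s (NExang.inducedClass s ξ) ↔
          NExang.RestrictionIsNExact s (NExang.inducedClass s ξ))) ∧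
    (∀ P : NExang.AngulatedPresentation n E s,
      ∀ ξ : NExang.SigmaSeq n P.S → Prop,
        (∀ T, ξ T → P.Θ T) →
        NExang.ClosedUnderWeakIso s (P.inducedClass ξ) →
        (NExang.IsNProper s (P.inducedClass ξ) ↔
          NExang.RestrictionIsNExangulated s (P.inducedClass ξ))) :=
  ⟨fun hE _ _ hw => (corollary4p6_general hn h (fun _ _ _ _ hX => hX.1) hw).1 hE,
    fun _ _ _ hw => (corollary4p6_general hn h (fun _ _ _ _ hX => hX.1) hw).2⟩
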